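/- **Constraints.** A constraint of arity $k$ is a function $f:\{0,1\}^k\to\mathbb{R}^{\ge 0}$; for $k=2$ we write $f=(f(00),f(01),f(10),f(11))$. Let $\mathcal{U}$ be the set of all unary constraints, and let $IM_{opt}$ be the set of all constraints $f(x_1,\dots,x_k)$ that are finite products of unary constraints $u(x_i)$ and of binary constraints $(1,1,\lambda,1)$ with $0\le\lambda<1$, applied to pairs $(x_i,x_j)$. **Problems.** For a set $\mathcal{F}$ of constraints, MAX-PROD-CSP$^*(\mathcal{F})$ is the following maximization problem. An instance is a number $n$ of Boolean variables $x_1,\dots,x_n$ and a finite set $H$ of pairs $\langle h,(x_{i_1},\dots,x_{i_k})\rangle$ with $h\in\mathcal{F}\cup\mathcal{U}$ of arity $k$ and $i_1,\dots,i_k\in[n]$; a solution is an assignment $\sigma:\{x_1,\dots,x_n\}\to\{0,1\}$; its measure is $\prod_{\langle h,(x_{i_1},\dots,x_{i_k})\rangle\in H}h(\sigma(x_{i_1}),\dots,\sigma(x_{i_k}))$. In MAX-PROD-FLOW an instance is a finite directed graph $G=(V,E)$ with flow rates $\rho_e\ge 1$ $(e\in E)$ and influx rates $w_v\ge 0$ $(v\in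 V)$; a solution is an assignment $\sigma:V\to\{0,1\}$; its measure is $\bigl(\prod_{(x,y)\in E,\ \sigma(x)\ge\sigma(y)}\rho_{(x,y)}\bigr)\bigl(\prod_{z\in V,\ \sigma(z)=1}w_z\bigr)$. **Computation.** Algorithms are programs of a real RAM with exact unit-cost real arithmetic and comparisons (no rounding), natural-number registers and addresses, and fair random bits. Instances are given as finite sequences of natural and real numbers, and the size $|x|$ is the length of that sequence. Variables and vertices are listed, each constraint is given by the table of its $2^k$ values in lexicographic order together with the list of its arguments, and each edge is given by its two ends and its rate. **Reducibility.** For a maximization problem with measure $m$ and optimum value $m^*$, a solution $y$ of $x$ is $\alpha$-approximate if $1/\alpha\le|m(x,y)/m^*(x)|\le\alpha$, or $m(x,y)=0$ in the case $m^*(x)=0$. A randomized approximation scheme takes an instance $x$ and $\varepsilon\in(0,1)$, and outputs a $2^{\varepsilon}$-approximate solution of $x$ with probability at least $3/4$. A problem $P$ is APT-reducible to a problem $Q$ if there are a randomized oracle algorithm $N$ and two polynomials $p,r$ in two variables such that, for every (not necessarily time-bounded) randomized approximation scheme $M$ for $Q$ used as oracle: (i) $N$ is a randomized approximation scheme for $P$;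 (ii) on input $(x,\varepsilon)$, every oracle call is of the form $(w,\delta)$ with $w$ an instance of $Q$, $\delta\in(0,1)$ and $1/\delta\le p(|x|,1/\varepsilon)$, and it is answered by a fresh random outcome of $M$ on $(w,\delta)$; (iii) the running time of $N$ on $(x,\varepsilon)$ is at most $r(|x|,1/\varepsilon)$. **Lemma.** For every set $\mathcal{F}\subseteq IM_{opt}$ of constraints, MAX-PROD-CSP$^*(\mathcal{F})$ is APT-reducible to MAX-PROD-FLOW. -/

import Mathlib

open scoped NNReal ENNReal

namespace ProdCSP

/-! ### Words, and a randomized real RAM with an oracle -/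

/-- Machine data: a finite sequence of natural numbers together with a finite sequence of
real numbers. Every entry has unit size. -/
structure Word where
  nats : List ℕ
  reals : List ℝ

/-- The size of a word is its total number of entries. -/
def Word.size (w : Word) : ℕ := w.nats.length + w.reals.length

/-- Expressions with natural-number values: literals, registers, arithmetic (`sub` is truncated),
array access by a computed address, and array lengths. -/
inductive NExp where
  | lit (c : ℕ)
  | reg (v : ℕ)
  | add (a b : NExp)
  | sub (a b : NExp)
  | mul (a b : NExp)
  | get (arr : ℕ) (i : NExp)
  | lenN (arr : ℕ)
  | lenR (arr : ℕ)

/-- Expressions with real values. The only constants are natural numbers, and there is no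
rounding operation. -/
inductive RExp where
  | lit (c : ℕ)
  | reg (v : ℕ)
  | cast (a : NExp)
  | add (a b : RExp)
  | sub (a b : RExp)
  | mul (a b : RExp)
  | div (a b : RExp)
  | get (arr : ℕ) (i : NExp)

/-- Tests. -/
inductive BExp where
  | ltN (a b : NExp)
  | eqN (a b : NExp)
  | ltR (a b : RExp)
  | eqR (a b : RExp)
  | neg (p : BExp)
  | conj (p q : BExp)

/-- Programs of the machine. -/
inductive Stmt where
  | skip
  /-- assignment to a natural-number register -/
  | assignN (v : ℕ) (e : NExp)
  /-- assignment to a real register -/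
  | assignR (v : ℕ) (e : RExp)
  /-- append an entry to an array of natural numbers -/
  | pushN (arr : ℕ) (e : NExp)
  /-- append an entry to an array of reals -/
  | pushR (arr : ℕ) (e : RExp)
  /-- overwrite an existing entry of an array of natural numbers -/
  | setN (arr : ℕ) (i e : NExp)
  /-- overwrite an existing entry of an array of reals -/
  | setR (arr : ℕ) (i : NExp) (e : RExp)
  /-- empty an array of natural numbers -/
  | clearN (arr : ℕ)
  /-- empty an array of reals -/
  | clearR (arr : ℕ)
  /-- put a fair random bit into a natural-number register -/
  | flip (v : ℕ)
  /-- call the oracle on the word stored in the two arrays with name `q` and the tolerance given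
  by `e`; the answer replaces the two arrays with name `a` -/
  | query (q a : ℕ) (e : RExp)
  | seq (s t : Stmt)
  | ite (b : BExp) (s t : Stmt)
  | loop (b : BExp) (s : Stmt)

/-- The memory: registers and dynamic arrays, for natural numbers and for reals. -/
structure Mem where
  nreg : ℕ → ℕ
  rreg : ℕ → ℝ
  narr : ℕ → List ℕ
  rarr : ℕ → List ℝ

/-- The word stored in the two arrays with name `a`. -/
def Mem.word (s : Mem) (a : ℕ) : Word := ⟨s.narr a, s.rarr a⟩

/-- Replace the two arrays with name `a`. -/
def Mem.load (s : Mem) (a : ℕ) (w : Word) : Mem :=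
  { s with narr := Function.update s.narr a w.nats, rarr := Function.update s.rarr a w.reals }

/-- Reading beyond the end of an array gives `0`. -/
def NExp.eval (s : Mem) : NExp → ℕ
  | .lit c => c
  | .reg v => s.nreg v
  | .add a b => a.eval s + b.eval s
  | .sub a b => a.eval s - b.eval s
  | .mul a b => a.eval s * b.eval s
  | .get arr i => (s.narr arr).getD (i.eval s) 0
  | .lenN arr => (s.narr arr).length
  | .lenR arr => (s.rarr arr).length

/-- Division by zero and reading beyond the end of an array give `0`. -/
noncomputable def RExp.eval (s : Mem) : RExp → ℝ
  | .lit c => c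
  | .reg v => s.rreg v
  | .cast a => a.eval s
  | .add a b => a.eval s + b.eval s
  | .sub a b => a.eval s - b.eval s
  | .mul a b => a.eval s * b.eval s
  | .div a b => a.eval s / b.eval s
  | .get arr i => (s.rarr arr).getD (i.eval s) 0

noncomputable def BExp.eval (s : Mem) : BExp → Bool
  | .ltN a b => decide (a.eval s < b.eval s)
  | .eqN a b => decide (a.eval s = b.eval s)
  | .ltR a b => decide (a.eval s < b.eval s)
  | .eqR a b => decide (a.eval s = b.eval s)
  | .neg p => !p.eval s
  | .conj p q => p.eval s && q.eval s

/-- A configuration: the stack of statements still to be executed, and the memory. -/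
structure Cfg where
  todo : List Stmt
  mem : Mem

/-- An oracle returns a random word on each pair of a word and a tolerance. Different calls are
answered independently. -/
abbrev Oracle := Word → ℝ → PMF Word

/-- One step of the machine. A configuration with nothing left to execute has halted and is
left unchanged. -/
noncomputable def step (M : Oracle) (c : Cfg) : PMF Cfg :=
  match c.todo with
  | [] => PMF.pure c
  | .skip :: k => PMF.pure ⟨k, c.mem⟩
  | .assignN v e :: k =>
      PMF.pure ⟨k, { c.mem with nreg := Function.update c.mem.nreg v (e.eval c.mem) }⟩
  | .assignR v e :: k =>
      PMF.pure ⟨k, { c.mem with rreg := Function.update c.mem.rreg v (e.eval c.mem) }⟩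
  | .pushN arr e :: k =>
      PMF.pure ⟨k, { c.mem with
        narr := Function.update c.mem.narr arr (c.mem.narr arr ++ [e.eval c.mem]) }⟩
  | .pushR arr e :: k =>
      PMF.pure ⟨k, { c.mem with
        rarr := Function.update c.mem.rarr arr (c.mem.rarr arr ++ [e.eval c.mem]) }⟩
  | .setN arr i e :: k =>
      PMF.pure ⟨k, { c.mem with
        narr := Function.update c.mem.narr arr
          ((c.mem.narr arr).set (i.eval c.mem) (e.eval c.mem)) }⟩
  | .setR arr i e :: k =>
      PMF.pure ⟨k, { c.mem with
        rarr := Function.update c.mem.rarr arr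
          ((c.mem.rarr arr).set (i.eval c.mem) (e.eval c.mem)) }⟩
  | .clearN arr :: k =>
      PMF.pure ⟨k, { c.mem with narr := Function.update c.mem.narr arr [] }⟩
  | .clearR arr :: k =>
      PMF.pure ⟨k, { c.mem with rarr := Function.update c.mem.rarr arr [] }⟩
  | .flip v :: k =>
      (PMF.uniformOfFintype Bool).map fun b =>
        ⟨k, { c.mem with nreg := Function.update c.mem.nreg v (if b then 1 else 0) }⟩
  | .query q a e :: k =>
      (M (c.mem.word q) (e.eval c.mem)).map fun w => ⟨k, c.mem.load a w⟩
  | .seq s t :: k => PMF.pure ⟨s :: t :: k, c.mem⟩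
  | .ite b s t :: k => PMF.pure ⟨(if b.eval c.mem then s else t) :: k, c.mem⟩
  | .loop b s :: k => PMF.pure ⟨if b.eval c.mem then s :: .loop b s :: k else k, c.mem⟩

/-- The distribution of the configuration after `t` steps. -/
noncomputable def run (M : Oracle) : ℕ → Cfg → PMF Cfg
  | 0, c => PMF.pure c
  | t + 1, c => (step M c).bind (run M t)

/-- The initial configuration: the input word is in the arrays with name `0`, the tolerance is in
the real register `0`, and everything else is zero or empty. -/
noncomputable def initCfg (prog : Stmt) (w : Word) (ε : ℝ) : Cfg :=
  ⟨[prog], Mem.load ⟨fun _ => 0, fun v => if v = 0 then ε else 0, fun _ => [], fun _ => []⟩ 0 w⟩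

def Cfg.Halted (c : Cfg) : Prop := c.todo = []

/-- The output is the content of the arrays with name `1`. -/
def Cfg.output (c : Cfg) : Word := c.mem.word 1

/-- The next step of `c` is an oracle call, on the word `w` with tolerance `δ`. -/
def Cfg.Asks (c : Cfg) (w : Word) (δ : ℝ) : Prop :=
  ∃ q a e k, c.todo = .query q a e :: k ∧ w = c.mem.word q ∧ δ = e.eval c.mem

/-! ### Maximization problems and approximation-preserving Turing reductions -/

/-- A maximization problem, with instances and solutions represented by words. -/
structure MaxProblem where
  Inst : Type
  Sol : Inst → Type
  measure : (x : Inst) → Sol x → ℝ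
  encInst : Inst → Word
  encSol : (x : Inst) → Sol x → Word

namespace MaxProblem

/-- The size of an instance is the size of the word that represents it. -/
def size (P : MaxProblem) (x : P.Inst) : ℕ := (P.encInst x).size

/-- `v` is the optimum value of the instance `x`. -/
def IsOptimum (P : MaxProblem) (x : P.Inst) (v : ℝ) : Prop :=
  IsGreatest (Set.range (P.measure x)) v

/-- `y` is an `α`-approximate solution for `x`. -/
def IsApprox (P : MaxProblem) (α : ℝ) (x : P.Inst) (y : P.Sol x) : Prop :=
  ∃ v, P.IsOptimum x v ∧
    (v = 0 → P.measure x y = 0) ∧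
    (v ≠ 0 → 1 / α ≤ |P.measure x y / v| ∧ |P.measure x y / v| ≤ α)

/-- A random word that represents a `2 ^ ε`-approximate solution for `x` with probability at
least `3/4`. -/
def GoodOutput (P : MaxProblem) (x : P.Inst) (ε : ℝ) (d : PMF Word) : Prop :=
  3 / 4 ≤ d.toOuterMeasure
    {w : Word | ∃ y : P.Sol x, P.encSol x y = w ∧ P.IsApprox ((2 : ℝ) ^ ε) x y}

/-- `M` acts as a randomized approximation scheme for `P`: nothing is said about words that do not
represent instances, about tolerances outside `(0,1)`, or about the remaining answers. -/
def IsScheme (P : MaxProblem) (M : Oracle) : Prop :=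
  ∀ (x : P.Inst) (ε : ℝ), 0 < ε → ε < 1 → P.GoodOutput x ε (M (P.encInst x) ε)

/-- The value of a polynomial in two variables at `(|x|, 1/ε)`. -/
noncomputable def bound (P : MaxProblem) (p : MvPolynomial (Fin 2) ℝ) (x : P.Inst) (ε : ℝ) : ℝ :=
  MvPolynomial.eval ![(P.size x : ℝ), 1 / ε] p

/-- Polynomial-time randomized approximation-preserving Turing reducibility of `P` to `Q`. The
program and the polynomials do not depend on the oracle, the instance or the tolerance. -/
def APTReducible (P Q : MaxProblem) : Prop :=
  ∃ (prog : Stmt) (p r : MvPolynomial (Fin 2) ℝ),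
    ∀ M : Oracle, Q.IsScheme M →
      ∀ (x : P.Inst) (ε : ℝ), 0 < ε → ε < 1 →
        -- every oracle call on every computation path is admissible
        (∀ t, ∀ c ∈ (run M t (initCfg prog (P.encInst x) ε)).support,
          ∀ (w : Word) (δ : ℝ), c.Asks w δ →
            (∃ z : Q.Inst, w = Q.encInst z) ∧ 0 < δ ∧ δ < 1 ∧ 1 / δ ≤ P.bound p x ε) ∧
        -- every computation path halts in polynomial time, and the output is good
        ∃ t : ℕ, (t : ℝ) ≤ P.bound r x ε ∧
          (∀ c ∈ (run M t (initCfg prog (P.encInst x) ε)).support, c.Halted) ∧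
          P.GoodOutput x ε ((run M t (initCfg prog (P.encInst x) ε)).map Cfg.output)

end MaxProblem

/-! ### Constraints -/

/-- A nonnegative-real-weighted Boolean constraint. -/
structure Constraint where
  arity : ℕ
  val : (Fin arity → Bool) → ℝ≥0

/-- The set of all unary constraints. -/
def unaryConstraints : Set Constraint := {f | f.arity = 1}

/-- The values of a function on `{0,1}^k` in lexicographic order of the arguments. -/
def table : (k : ℕ) → ((Fin k → Bool) → ℝ≥0) → List ℝ
  | 0, f => [(f Fin.elim0 : ℝ)]
  | k + 1, f =>
      table k (fun x => f (Fin.cons false x)) ++ table k (fun x => f (Fin.cons true x))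

/-- A unary constraint applied to the variable `x_i`, or the binary constraint `(1,1,lam,1)`
applied to `(x_i, x_j)`. -/
inductive ImFactor (k : ℕ) where
  | unary (i : Fin k) (u : Bool → ℝ≥0)
  | imp (i j : Fin k) (lam : ℝ≥0) (h : lam < 1)

def ImFactor.eval {k : ℕ} (x : Fin k → Bool) : ImFactor k → ℝ≥0
  | .unary i u => u (x i)
  | .imp i j lam _ => if x i = true ∧ x j = false then lam else 1

/-- The constraints that are products of unary constraints and of constraints `(1,1,lam,1)` with
`0 ≤ lam < 1`. -/
def IMopt : Set Constraint :=
  {f | ∃ L : List (ImFactor f.arity), ∀ x, f.val x = (L.map (ImFactor.eval x)).prod}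

/-! ### The problems -/

/-- A Boolean assignment as a word: its bits. -/
def encAssignment {n : ℕ} (σ : Fin n → Bool) : Word :=
  ⟨List.ofFn fun i => if σ i then 1 else 0, []⟩

/-- A constraint applied to a tuple of (not necessarily distinct) variables among `n` ones. -/
structure Application (n : ℕ) where
  h : Constraint
  args : Fin h.arity → Fin n

/-- An instance: a finite set, listed without repetition, of applications to `n` variables of
constraints from `F`. -/
structure CSPInst (F : Set Constraint) where
  n : ℕ
  apps : List (Application n)
  nodup : apps.Nodup
  mem : ∀ a ∈ apps, a.h ∈ F

/-- The natural-number part has the number `n` of variables, the list of the variables, the number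
of applications and, for each of these, its arity and its arguments; the real part has
the value tables of the constraints, one after the other. -/
def CSPInst.enc {F : Set Constraint} (x : CSPInst F) : Word where
  nats := x.n :: (List.range x.n ++ x.apps.length ::
    x.apps.flatMap fun a => a.h.arity :: List.ofFn fun i => (a.args i : ℕ))
  reals := x.apps.flatMap fun a => table a.h.arity a.h.val

/-- The problem MAX-PROD-CSP(F). -/
def maxProdCSP (F : Set Constraint) : MaxProblem where
  Inst := CSPInst F
  Sol x := Fin x.n → Bool
  measure x σ := ((x.apps.map fun a => a.h.val fun i => σ (a.args i)).prod : ℝ≥0)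
  encInst := CSPInst.enc
  encSol _ σ := encAssignment σ

/-- The problem MAX-PROD-CSP*(F), in which all unary constraints are free. -/
def maxProdCSPStar (F : Set Constraint) : MaxProblem := maxProdCSP (F ∪ unaryConstraints)

/-- An instance of MAX-PROD-FLOW: a directed graph on `n` vertices, given by the list, without
repetition, of its edges with their flow rates; and the influx rates of the vertices. -/
structure FlowInst where
  n : ℕ
  edges : List ((Fin n × Fin n) × ℝ)
  nodup : (edges.map Prod.fst).Nodup
  one_le : ∀ e ∈ edges, 1 ≤ e.2
  influx : Fin n → ℝ≥0

/-- The natural-number part has the number of vertices, the number of edges and the two ends of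
each edge; the real part has the influx rates, followed by the flow rates. -/
def FlowInst.enc (x : FlowInst) : Word where
  nats := x.n :: x.edges.length :: x.edges.flatMap fun e => [(e.1.1 : ℕ), (e.1.2 : ℕ)]
  reals := (List.ofFn fun v => (x.influx v : ℝ)) ++ x.edges.map Prod.snd

/-- The problem MAX-PROD-FLOW. -/
def maxProdFlow : MaxProblem where
  Inst := FlowInst
  Sol x := Fin x.n → Bool
  measure x σ :=
    ((x.edges.filter fun e => decide (σ e.1.1 ≥ σ e.1.2)).map Prod.snd).prod *
      ∏ z : Fin x.n with σ z = true, (x.influx z : ℝ)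
  encInst := FlowInst.enc
  encSol _ σ := encAssignment σ

end ProdCSP

/-! Where a factor `(1, 1, λ, 1)` at `(x_i, x_j)` does not vanish, it is `λ ^ [x_i]` times
`(1 / λ) ^ [x_i ∧ x_j]`, or `1` if `λ = 0`. Hence on its support a constraint of `IMopt` is a
constant times a product of weights of true variables and of interactions, at least `1`, of pairs
of true variables. After equivalent variables are merged, only pairs without an implication between
them interact, and the values of the constraint on the smallest assignments that contain at most two
given variables determine all weights and interactions, without a factorization being known. Since
`[p ∧ q] = [p ≥ q] + [q] - 1`, an interaction of `p` and `q` is both a flow rate of `(p, q)` and a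
factor of the influx rate of `q`, up to a constant.

The support is given by implications `q → p`, by variables that must be true, and by variables that
must be false. The latter have influx rate `0`; the rates of the other conditions are multiplied by
a penalty so large that violating one of them at least halves every nonzero value otherwise
attained. As `2 ^ ε < 2`, an approximate solution satisfies all conditions if that is possible at
all. The penalty is an explicit product of the rates, so everything is computed exactly by a program
of the machine, which is compiled from terms with bounded iteration and calls the oracle once, with
the given tolerance. -/

namespace ProdCSP

/-! ### Deterministic executions -/

/-- A step from `c` to `c'` that makes no random choice and no oracle call. -/
structure DetStep (c c' : Cfg) : Prop where
  step_eq : ∀ M, step M c = PMF.pure c'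
  not_asks : ∀ w δ, ¬ c.Asks w δ

/-- `Reaches c c' b`: at most `b` deterministic steps lead from `c` to `c'`. -/
inductive Reaches : Cfg → Cfg → ℕ → Prop
  | refl (c : Cfg) (b : ℕ) : Reaches c c b
  | head {c c' c'' : Cfg} {b : ℕ} : DetStep c c' → Reaches c' c'' b → Reaches c c'' (b + 1)

theorem Reaches.mono {c c' : Cfg} {a b : ℕ} (h : Reaches c c' a) (hab : a ≤ b) :
    Reaches c c' b := by
  induction h generalizing b with
  | refl c => exact .refl c b
  | head hstep _ ih =>
    obtain ⟨b, rfl⟩ := Nat.exists_eq_add_of_le' (Nat.zero_lt_of_lt hab)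
    exact .head hstep (ih (Nat.le_of_succ_le_succ hab))

theorem Reaches.trans {c c' c'' : Cfg} {a b : ℕ} (h : Reaches c c' a) (h' : Reaches c' c'' b) :
    Reaches c c'' (a + b) := by
  induction h with
  | refl c a => exact h'.mono (Nat.le_add_left b a)
  | @head _ _ _ a hstep _ ih => exact Nat.add_right_comm a b 1 ▸ .head hstep (ih h')

theorem Reaches.run_eq {c c' : Cfg} {b : ℕ} (h : Reaches c c' b) (M : Oracle) :
    ∃ t ≤ b, ∀ u, run M (t + u) c = run M u c' := by
  induction h with
  | refl c b => exact ⟨0, b.zero_le, fun u => by rw [Nat.zero_add]⟩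
  | head hstep _ ih =>
    obtain ⟨t, ht, hrun⟩ := ih
    refine ⟨t + 1, Nat.succ_le_succ ht, fun u => ?_⟩
    rw [Nat.add_right_comm, run, hstep.step_eq, PMF.pure_bind, hrun]

theorem Reaches.not_asks_or_mem_support {c c' d : Cfg} {b u : ℕ} {M : Oracle}
    (h : Reaches c c' b) (hd : d ∈ (run M u c).support) :
    (∀ w δ, ¬ d.Asks w δ) ∨ ∃ v, d ∈ (run M v c').support := by
  induction h generalizing u with
  | refl => exact .inr ⟨u, hd⟩
  | head hstep _ ih =>
    cases u with
    | zero =>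
      obtain rfl : d = _ := by simpa only [run, PMF.mem_support_pure_iff] using hd
      exact .inl hstep.not_asks
    | succ u =>
      rw [run, hstep.step_eq, PMF.pure_bind] at hd
      exact ih hd

/-- `Exec s m m' b`: the statement `s` turns the memory `m` into `m'` within `b` steps, whatever
remains to be executed after `s`, without random choices and oracle calls. -/
def Exec (s : Stmt) (m m' : Mem) (b : ℕ) : Prop := ∀ k, Reaches ⟨s :: k, m⟩ ⟨k, m'⟩ b

theorem Exec.of_step {s : Stmt} {m m' : Mem} (hstep : ∀ M k, step M ⟨s :: k, m⟩ = PMF.pure ⟨k, m'⟩)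
    (hs : ∀ q a e, s ≠ .query q a e) : Exec s m m' 1 := fun k =>
  .head ⟨fun M => hstep M k, fun _ _ ⟨q, a, e, _, h, _⟩ => hs q a e (List.cons.inj h).1⟩ (.refl _ 0)

theorem Exec.of_unfold {s : Stmt} {m m' : Mem} {b : ℕ} {l : List Stmt}
    (hstep : ∀ M k, step M ⟨s :: k, m⟩ = PMF.pure ⟨l ++ k, m⟩)
    (hs : ∀ q a e, s ≠ .query q a e) (h : ∀ k, Reaches ⟨l ++ k, m⟩ ⟨k, m'⟩ b) :
    Exec s m m' (b + 1) := fun k =>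
  .head ⟨fun M => hstep M k, fun _ _ ⟨q, a, e, _, h, _⟩ => hs q a e (List.cons.inj h).1⟩ (h k)

theorem Exec.seq {s t : Stmt} {m₁ m₂ m₃ : Mem} {a b : ℕ} (h : Exec s m₁ m₂ a)
    (h' : Exec t m₂ m₃ b) : Exec (.seq s t) m₁ m₃ (a + b + 1) :=
  .of_unfold (l := [s, t]) (fun _ _ => rfl) nofun fun k => (h (t :: k)).trans (h' k)

theorem Exec.ite {b : BExp} {s t : Stmt} {m m' : Mem} {a : ℕ}
    (h : Exec (if b.eval m then s else t) m m' a) : Exec (.ite b s t) m m' (a + 1) :=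
  .of_unfold (l := [if b.eval m then s else t]) (fun _ _ => rfl) nofun h

theorem Exec.loop_done {b : BExp} {s : Stmt} {m : Mem} (hb : b.eval m = false) :
    Exec (.loop b s) m m 1 :=
  .of_step (fun _ _ => by simp only [step, hb, Bool.false_eq_true, if_false]) nofun

theorem Exec.loop_next {b : BExp} {s : Stmt} {m₁ m₂ m₃ : Mem} {i j : ℕ} (hb : b.eval m₁ = true)
    (h : Exec s m₁ m₂ i) (h' : Exec (.loop b s) m₂ m₃ j) :
    Exec (.loop b s) m₁ m₃ (i + j + 1) :=
  .of_unfold (l := [s, .loop b s])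
    (fun _ _ => by simp only [step, hb, if_true, List.cons_append, List.nil_append]) nofun
    fun k => (h (.loop b s :: k)).trans (h' k)

/-- A timed total-correctness assertion: started in `m`, the statement `s` ends deterministically
within `b` steps in a memory that satisfies `Q`. -/
def Ensures (s : Stmt) (b : ℕ) (Q : Mem → Prop) (m : Mem) : Prop := ∃ m', Exec s m m' b ∧ Q m'

namespace Ensures

variable {s t : Stmt} {a b : ℕ} {Q R : Mem → Prop} {m : Mem}

theorem mono (h : Ensures s a R m) (hab : a ≤ b) (hQ : ∀ m', R m' → Q m') : Ensures s b Q m :=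
  let ⟨m', h, hR⟩ := h; ⟨m', fun k => (h k).mono hab, hQ m' hR⟩

theorem seq (h : Ensures s a R m) (h' : ∀ m', R m' → Ensures t b Q m') :
    Ensures (.seq s t) (a + b + 1) Q m :=
  let ⟨m₁, h, hR⟩ := h; let ⟨m₂, h', hQ⟩ := h' m₁ hR; ⟨m₂, h.seq h', hQ⟩

theorem ite {p : BExp} (h : Ensures (if p.eval m then s else t) a Q m) :
    Ensures (.ite p s t) (a + 1) Q m :=
  let ⟨m', h, hQ⟩ := h; ⟨m', h.ite, hQ⟩

theorem skip (h : Q m) : Ensures .skip 1 Q m := ⟨m, .of_step (fun _ _ => rfl) nofun, h⟩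

end Ensures

/-- Set a natural-number register. -/
def Mem.setNat (m : Mem) (v x : ℕ) : Mem := { m with nreg := Function.update m.nreg v x }

/-- Set a real register. -/
def Mem.setReal (m : Mem) (v : ℕ) (x : ℝ) : Mem := { m with rreg := Function.update m.rreg v x }

theorem Ensures.assignN {v : ℕ} {e : NExp} {Q : Mem → Prop} {m : Mem}
    (h : Q (m.setNat v (e.eval m))) : Ensures (.assignN v e) 1 Q m :=
  ⟨_, .of_step (fun _ _ => rfl) nofun, h⟩

theorem Ensures.assignR {v : ℕ} {e : RExp} {Q : Mem → Prop} {m : Mem}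
    (h : Q (m.setReal v (e.eval m))) : Ensures (.assignR v e) 1 Q m :=
  ⟨_, .of_step (fun _ _ => rfl) nofun, h⟩

/-- The loop that runs the register `v` from its present value up to the size of the word in the
arrays with name `0`. -/
def forLoop (v : ℕ) (body : Stmt) : Stmt :=
  .loop (.ltN (.reg v) (.add (.lenN 0) (.lenR 0)))
    (.seq body (.assignN v (.add (.reg v) (.lit 1))))

theorem Ensures.forLoop {v B c : ℕ} {body : Stmt} {Inv : ℕ → Mem → Prop}
    (hsize : ∀ i m, Inv i m → (m.word 0).size = B) (hv : ∀ i m, Inv i m → m.nreg v = i)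
    (hbody : ∀ i m, i < B → Inv i m →
      Ensures body c (fun m' => Inv (i + 1) (m'.setNat v (m'.nreg v + 1))) m)
    {m : Mem} (hm : Inv 0 m) :
    Ensures (forLoop v body) (B * (c + 3) + 1) (Inv B) m := by
  suffices H : ∀ r i, i + r = B → ∀ m, Inv i m →
      Ensures (ProdCSP.forLoop v body) (r * (c + 3) + 1) (Inv B) m from H B 0 (Nat.zero_add B) m hm
  intro r
  induction r with
  | zero =>
    rintro i rfl m hm
    refine ⟨m, (Nat.zero_mul (c + 3)).symm ▸ Exec.loop_done ?_, hm⟩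
    exact decide_eq_false (Nat.not_lt.2 ((hsize _ m hm).trans (hv _ m hm).symm).le)
  | succ r ih =>
    intro i hi m hm
    have hguard : (BExp.ltN (.reg v) (.add (.lenN 0) (.lenR 0))).eval m = true :=
      decide_eq_true (show m.nreg v < (m.word 0).size by rw [hv i m hm, hsize i m hm]; omega)
    obtain ⟨m₁, hexec, hInv⟩ :=
      (hbody i m (by omega) hm).seq fun m' h' => Ensures.assignN (e := .add (.reg v) (.lit 1)) h'
    obtain ⟨m₂, hexec', hInv'⟩ := ih (i + 1) (by omega) m₁ hInv
    exact Ensures.mono ⟨m₂, hexec.loop_next hguard hexec', hInv'⟩ (by rw [Nat.succ_mul]; omega)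
      fun _ => id

/-! ### Terms with bounded iteration, and their compilation -/

/-- Terms with natural-number values over an input word `w` and an environment, a list of natural
numbers in which variables are looked up by position. The values bound by `bind`, `sum` and `iter`
are put in front of the environment, and all iterations run `w.size` times. -/
inductive NTerm where
  | lit (c : ℕ)
  | var (j : ℕ)
  | add (a b : NTerm)
  | sub (a b : NTerm)
  | mul (a b : NTerm)
  | getN (i : NTerm)
  | isZero (i : NTerm)
  | bind (a b : NTerm)
  | call (θ : List ℕ) (a : NTerm)
  | ite (c a b : NTerm)
  | sum (a : NTerm)
  | iter (a b : NTerm)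

/-- Terms with real values, with the conventions of `NTerm`. -/
inductive RTerm where
  | lit (c : ℕ)
  | getR (i : NTerm)
  | add (a b : RTerm)
  | mul (a b : RTerm)
  | div (a b : RTerm)
  | bind (a : NTerm) (b : RTerm)
  | call (θ : List ℕ) (a : RTerm)
  | ite (c : NTerm) (a b : RTerm)
  | prod (a : RTerm)

/-- Commands that emit a sequence of natural and real numbers, with the conventions of `NTerm`. -/
inductive Cmd where
  | emitN (a : NTerm)
  | emitR (a : RTerm)
  | seq (a b : Cmd)
  | guard (c : NTerm) (a : Cmd)
  | loop (a : Cmd)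

/-- The environment seen by a subterm that is called with the variables `θ`. -/
def pick (θ : List ℕ) (l : List ℕ) : List ℕ := θ.map fun j => l.getD j 0

/-- The value of a term. As a test, a term fails if its value is `0` and holds otherwise. -/
noncomputable def NTerm.eval (w : Word) : NTerm → List ℕ → ℕ
  | .lit c, _ => c
  | .var j, l => l.getD j 0
  | .add a b, l => a.eval w l + b.eval w l
  | .sub a b, l => a.eval w l - b.eval w l
  | .mul a b, l => a.eval w l * b.eval w l
  | .getN i, l => w.nats.getD (i.eval w l) 0
  | .isZero i, l => if w.reals.getD (i.eval w l) 0 = 0 then 1 else 0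
  | .bind a b, l => b.eval w (a.eval w l :: l)
  | .call θ a, l => a.eval w (pick θ l)
  | .ite c a b, l => if c.eval w l = 0 then b.eval w l else a.eval w l
  | .sum a, l => ∑ i ∈ Finset.range w.size, a.eval w (i :: l)
  | .iter a b, l => Nat.rec (a.eval w l) (fun i y => b.eval w (y :: i :: l)) w.size

/-- The value of a real term. -/
noncomputable def RTerm.eval (w : Word) : RTerm → List ℕ → ℝ
  | .lit c, _ => c
  | .getR i, l => w.reals.getD (i.eval w l) 0
  | .add a b, l => a.eval w l + b.eval w l
  | .mul a b, l => a.eval w l * b.eval w l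
  | .div a b, l => a.eval w l / b.eval w l
  | .bind a b, l => b.eval w (a.eval w l :: l)
  | .call θ a, l => a.eval w (pick θ l)
  | .ite c a b, l => if c.eval w l = 0 then b.eval w l else a.eval w l
  | .prod a, l => ∏ i ∈ Finset.range w.size, a.eval w (i :: l)

/-- The numbers emitted by a command. -/
noncomputable def Cmd.out (w : Word) : Cmd → List ℕ → List (ℕ ⊕ ℝ)
  | .emitN a, l => [.inl (a.eval w l)]
  | .emitR a, l => [.inr (a.eval w l)]
  | .seq a b, l => a.out w l ++ b.out w l
  | .guard c a, l => if c.eval w l = 0 then [] else a.out w l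
  | .loop a, l => (List.range w.size).flatMap fun i => a.out w (i :: l)

/-- Code for a term. The list `Γ` has the registers of the variables, register `0` is zero, the
registers from `d` on are free, and the value is left in register `d`. -/
def NTerm.code : NTerm → List ℕ → ℕ → Stmt
  | .lit c, _, d => .assignN d (.lit c)
  | .var j, Γ, d => .assignN d (.reg (Γ.getD j 0))
  | .add a b, Γ, d =>
      .seq (a.code Γ d) (.seq (b.code Γ (d + 1)) (.assignN d (.add (.reg d) (.reg (d + 1)))))
  | .sub a b, Γ, d =>
      .seq (a.code Γ d) (.seq (b.code Γ (d + 1)) (.assignN d (.sub (.reg d) (.reg (d + 1)))))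
  | .mul a b, Γ, d =>
      .seq (a.code Γ d) (.seq (b.code Γ (d + 1)) (.assignN d (.mul (.reg d) (.reg (d + 1)))))
  | .getN i, Γ, d => .seq (i.code Γ d) (.assignN d (.get 0 (.reg d)))
  | .isZero i, Γ, d =>
      .seq (i.code Γ d) (.ite (.eqR (.get 0 (.reg d)) (.lit 0))
        (.assignN d (.lit 1)) (.assignN d (.lit 0)))
  | .bind a b, Γ, d =>
      .seq (a.code Γ d) (.seq (b.code (d :: Γ) (d + 1)) (.assignN d (.reg (d + 1))))
  | .call θ a, Γ, d => a.code (pick θ Γ) d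
  | .ite c a b, Γ, d =>
      .seq (c.code Γ d) (.ite (.eqN (.reg d) (.lit 0)) (b.code Γ d) (a.code Γ d))
  | .sum a, Γ, d =>
      .seq (.assignN d (.lit 0)) (.seq (.assignN (d + 1) (.lit 0))
        (forLoop (d + 1) (.seq (a.code ((d + 1) :: Γ) (d + 2))
          (.assignN d (.add (.reg d) (.reg (d + 2)))))))
  | .iter a b, Γ, d =>
      .seq (a.code Γ d) (.seq (.assignN (d + 1) (.lit 0))
        (forLoop (d + 1) (.seq (b.code (d :: (d + 1) :: Γ) (d + 2))
          (.assignN d (.reg (d + 2))))))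

/-- Code for a real term, with the conventions of `NTerm.code` for the natural-number registers.
The real registers from `r` on are free, and the value is left in the real register `r`. -/
def RTerm.code : RTerm → List ℕ → ℕ → ℕ → Stmt
  | .lit c, _, _, r => .assignR r (.lit c)
  | .getR i, Γ, d, r => .seq (i.code Γ d) (.assignR r (.get 0 (.reg d)))
  | .add a b, Γ, d, r =>
      .seq (a.code Γ d r) (.seq (b.code Γ d (r + 1)) (.assignR r (.add (.reg r) (.reg (r + 1)))))
  | .mul a b, Γ, d, r =>
      .seq (a.code Γ d r) (.seq (b.code Γ d (r + 1)) (.assignR r (.mul (.reg r) (.reg (r + 1)))))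
  | .div a b, Γ, d, r =>
      .seq (a.code Γ d r) (.seq (b.code Γ d (r + 1)) (.assignR r (.div (.reg r) (.reg (r + 1)))))
  | .bind a b, Γ, d, r => .seq (a.code Γ d) (b.code (d :: Γ) (d + 1) r)
  | .call θ a, Γ, d, r => a.code (pick θ Γ) d r
  | .ite c a b, Γ, d, r =>
      .seq (c.code Γ d) (.ite (.eqN (.reg d) (.lit 0)) (b.code Γ d r) (a.code Γ d r))
  | .prod a, Γ, d, r =>
      .seq (.assignR r (.lit 1)) (.seq (.assignN d (.lit 0))
        (forLoop d (.seq (a.code (d :: Γ) (d + 1) (r + 1))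
          (.assignR r (.mul (.reg r) (.reg (r + 1)))))))

/-- Code for a command, which appends the emitted numbers to the arrays with name `2`. The real
register `0`, where the tolerance is, stays unchanged. -/
def Cmd.code : Cmd → List ℕ → ℕ → Stmt
  | .emitN a, Γ, d => .seq (a.code Γ d) (.pushN 2 (.reg d))
  | .emitR a, Γ, d => .seq (a.code Γ d 1) (.pushR 2 (.reg 1))
  | .seq a b, Γ, d => .seq (a.code Γ d) (b.code Γ d)
  | .guard c a, Γ, d => .seq (c.code Γ d) (.ite (.eqN (.reg d) (.lit 0)) .skip (a.code Γ d))
  | .loop a, Γ, d => .seq (.assignN d (.lit 0)) (forLoop d (a.code (d :: Γ) (d + 1)))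

section Cost

open Polynomial

/-- A bound for the running time of the code of a term, in terms of the size of the input. -/
noncomputable def NTerm.cost : NTerm → ℕ[X]
  | .lit _ => 1
  | .var _ => 1
  | .add a b => a.cost + b.cost + 3
  | .sub a b => a.cost + b.cost + 3
  | .mul a b => a.cost + b.cost + 3
  | .getN i => i.cost + 2
  | .isZero i => i.cost + 3
  | .bind a b => a.cost + b.cost + 3
  | .call _ a => a.cost
  | .ite c a b => c.cost + a.cost + b.cost + 2
  | .sum a => X * (a.cost + 5) + 5
  | .iter a b => a.cost + X * (b.cost + 5) + 4

/-- A bound for the running time of the code of a real term, in terms of the size of the input. -/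
noncomputable def RTerm.cost : RTerm → ℕ[X]
  | .lit _ => 1
  | .getR i => i.cost + 2
  | .add a b => a.cost + b.cost + 3
  | .mul a b => a.cost + b.cost + 3
  | .div a b => a.cost + b.cost + 3
  | .bind a b => a.cost + b.cost + 1
  | .call _ a => a.cost
  | .ite c a b => c.cost + a.cost + b.cost + 2
  | .prod a => X * (a.cost + 5) + 5

/-- A bound for the running time of the code of a command, in terms of the size of the input. -/
noncomputable def Cmd.cost : Cmd → ℕ[X]
  | .emitN a => a.cost + 2
  | .emitR a => a.cost + 2
  | .seq a b => a.cost + b.cost + 1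
  | .guard c a => c.cost + a.cost + 3
  | .loop a => X * (a.cost + 3) + 3

end Cost

/-- In the memory `m`, the input `w` is in place, register `0` is zero, and the registers in `Γ` are
below `d` and hold the environment `l`. -/
structure Frame (w : Word) (l Γ : List ℕ) (d : ℕ) (m : Mem) : Prop where
  input : m.word 0 = w
  pos : 0 < d
  zero : m.nreg 0 = 0
  lt : ∀ v ∈ Γ, v < d
  env : Γ.map m.nreg = l

/-- The memories `m` and `m'` agree, except perhaps on the natural-number registers from `d` on and
the real registers from `r` on. -/
structure Keeps (d r : ℕ) (m m' : Mem) : Prop where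
  nreg : Set.EqOn m'.nreg m.nreg (Set.Iio d)
  rreg : Set.EqOn m'.rreg m.rreg (Set.Iio r)
  narr : m'.narr = m.narr
  rarr : m'.rarr = m.rarr

namespace Keeps

variable {d d' r r' v : ℕ} {m m' m'' : Mem}

theorem refl (d r : ℕ) (m : Mem) : Keeps d r m m := ⟨Set.eqOn_refl _ _, Set.eqOn_refl _ _, rfl, rfl⟩

theorem trans (h : Keeps d r m m') (h' : Keeps d r m' m'') : Keeps d r m m'' :=
  ⟨h'.nreg.trans h.nreg, h'.rreg.trans h.rreg, h'.narr.trans h.narr, h'.rarr.trans h.rarr⟩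

theorem mono (h : Keeps d' r' m m') (hd : d ≤ d') (hr : r ≤ r') : Keeps d r m m' :=
  ⟨h.nreg.mono (Set.Iio_subset_Iio hd), h.rreg.mono (Set.Iio_subset_Iio hr), h.narr, h.rarr⟩

theorem setNat (h : Keeps d r m m') (hv : d ≤ v) (x : ℕ) : Keeps d r m (m'.setNat v x) :=
  h.trans ⟨fun _ hi => Function.update_of_ne (ne_of_lt (lt_of_lt_of_le hi hv)) _ _,
    Set.eqOn_refl _ _, rfl, rfl⟩

theorem setReal (h : Keeps d r m m') (hv : r ≤ v) (x : ℝ) : Keeps d r m (m'.setReal v x) :=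
  h.trans ⟨Set.eqOn_refl _ _,
    fun _ hi => Function.update_of_ne (ne_of_lt (lt_of_lt_of_le hi hv)) _ _, rfl, rfl⟩

theorem word_eq (h : Keeps d r m m') (a : ℕ) : m'.word a = m.word a := by
  simp only [Mem.word, h.narr, h.rarr]

end Keeps

@[simp]
theorem Mem.setNat_nreg_self (m : Mem) (v x : ℕ) : (m.setNat v x).nreg v = x :=
  Function.update_self ..

theorem Mem.setNat_nreg_of_ne (m : Mem) {u v : ℕ} (h : u ≠ v) (x : ℕ) :
    (m.setNat v x).nreg u = m.nreg u :=
  Function.update_of_ne h ..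

@[simp]
theorem Mem.setReal_rreg_self (m : Mem) (v : ℕ) (x : ℝ) : (m.setReal v x).rreg v = x :=
  Function.update_self ..

namespace Frame

variable {w : Word} {l Γ : List ℕ} {d r : ℕ} {m m' : Mem}

theorem congr (h : Frame w l Γ d m) (hword : m'.word 0 = m.word 0)
    (hreg : Set.EqOn m'.nreg m.nreg (Set.Iio d)) : Frame w l Γ d m' where
  input := hword.trans h.input
  pos := h.pos
  zero := (hreg h.pos).trans h.zero
  lt := h.lt
  env := (List.map_congr_left fun v hv => hreg (h.lt v hv)).trans h.env

theorem keeps (h : Frame w l Γ d m) (hm : Keeps d r m m') : Frame w l Γ d m' :=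
  h.congr (hm.word_eq 0) hm.nreg

theorem mono {d' : ℕ} (h : Frame w l Γ d m) (hd : d ≤ d') : Frame w l Γ d' m :=
  ⟨h.input, h.pos.trans_le hd, h.zero, fun v hv => (h.lt v hv).trans_le hd, h.env⟩

theorem cons {v x : ℕ} (h : Frame w l Γ d m) (hv : v < d) (hx : m.nreg v = x) :
    Frame w (x :: l) (v :: Γ) d m :=
  ⟨h.input, h.pos, h.zero, List.forall_mem_cons.2 ⟨hv, h.lt⟩, by rw [List.map_cons, hx, h.env]⟩

theorem nreg_getD (h : Frame w l Γ d m) (j : ℕ) : m.nreg (Γ.getD j 0) = l.getD j 0 := by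
  rw [← h.env, ← h.zero, List.getD_map, h.zero]

theorem getD_lt (h : Frame w l Γ d m) (j : ℕ) : Γ.getD j 0 < d := by
  rcases lt_or_ge j Γ.length with hj | hj
  · exact List.getD_eq_getElem Γ 0 hj ▸ h.lt _ (List.getElem_mem hj)
  · rw [List.getD_eq_default Γ 0 hj]; exact h.pos

theorem pick (h : Frame w l Γ d m) (θ : List ℕ) :
    Frame w (ProdCSP.pick θ l) (ProdCSP.pick θ Γ) d m where
  input := h.input
  pos := h.pos
  zero := h.zero
  lt := List.forall_mem_map.2 fun j _ => h.getD_lt j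
  env := by
    rw [ProdCSP.pick, List.map_map]
    exact List.map_congr_left fun j _ => h.nreg_getD j

theorem narr_zero (h : Frame w l Γ d m) : m.narr 0 = w.nats := congrArg Word.nats h.input

theorem rarr_zero (h : Frame w l Γ d m) : m.rarr 0 = w.reals := congrArg Word.reals h.input

end Frame

namespace NTerm

/-- The code of a term computes its value within the time given by its cost, and keeps all
registers that are in use. -/
def Correct (w : Word) (e : NTerm) : Prop :=
  ∀ {l Γ : List ℕ} {d : ℕ} {m : Mem} (r : ℕ), Frame w l Γ d m →
    Ensures (e.code Γ d) (e.cost.eval w.size)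
      (fun m' => Keeps d r m m' ∧ m'.nreg d = e.eval w l) m

variable {w : Word} {a b c : NTerm}

theorem correct_lit (n : ℕ) : (lit n).Correct w := fun {_ _ d m} r _ =>
  Ensures.mono (.assignN ⟨(Keeps.refl d r m).setNat le_rfl n, m.setNat_nreg_self d n⟩)
    (by simp only [cost, Polynomial.eval_one, le_refl]) fun _ => id

theorem correct_var (j : ℕ) : (var j).Correct w := fun {_ _ d m} r hm =>
  Ensures.mono
    (.assignN ⟨(Keeps.refl d r m).setNat le_rfl _, (m.setNat_nreg_self d _).trans (hm.nreg_getD j)⟩)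
    (by simp only [cost, Polynomial.eval_one, le_refl]) fun _ => id

theorem Correct.binary {op : NExp → NExp → NExp} {f : ℕ → ℕ → ℕ}
    (hop : ∀ m x y, (op x y).eval m = f (x.eval m) (y.eval m)) (ha : a.Correct w)
    (hb : b.Correct w) {l Γ : List ℕ} {d : ℕ} {m : Mem} (r : ℕ) (hm : Frame w l Γ d m) :
    Ensures (.seq (a.code Γ d) (.seq (b.code Γ (d + 1)) (.assignN d (op (.reg d) (.reg (d + 1))))))
      (a.cost.eval w.size + b.cost.eval w.size + 3)
      (fun m' => Keeps d r m m' ∧ m'.nreg d = f (a.eval w l) (b.eval w l)) m := by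
  refine ((ha r hm).seq (b := b.cost.eval w.size + 2) fun m₁ ⟨h₁, hx⟩ => ?_).mono (by omega)
    fun _ => id
  refine (hb r ((hm.keeps h₁).mono d.le_succ)).seq fun m₂ ⟨h₂, hy⟩ => .assignN ?_
  refine ⟨(h₁.trans (h₂.mono d.le_succ le_rfl)).setNat le_rfl _, ?_⟩
  rw [Mem.setNat_nreg_self, hop, NExp.eval, NExp.eval, hy, h₂.nreg d.lt_succ_self, hx]

theorem Correct.add (ha : a.Correct w) (hb : b.Correct w) : (add a b).Correct w := fun r hm =>
  (ha.binary (fun _ _ _ => rfl) hb r hm).mono (by simp [cost]) fun _ => id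

theorem Correct.sub (ha : a.Correct w) (hb : b.Correct w) : (sub a b).Correct w := fun r hm =>
  (ha.binary (fun _ _ _ => rfl) hb r hm).mono (by simp [cost]) fun _ => id

theorem Correct.mul (ha : a.Correct w) (hb : b.Correct w) : (mul a b).Correct w := fun r hm =>
  (ha.binary (fun _ _ _ => rfl) hb r hm).mono (by simp [cost]) fun _ => id

theorem Correct.getN (ha : a.Correct w) : (getN a).Correct w := fun r hm =>
  ((ha r hm).seq fun m₁ ⟨h₁, hx⟩ => .assignN ⟨h₁.setNat le_rfl _, by
      rw [Mem.setNat_nreg_self, NExp.eval, NExp.eval, hx, (hm.keeps h₁).narr_zero, eval]⟩).mono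
    (by simp [cost]) fun _ => id

theorem Correct.isZero (ha : a.Correct w) : (isZero a).Correct w := fun {l _ d m} r hm => by
  refine ((ha r hm).seq (b := 2) fun m₁ ⟨h₁, hx⟩ => Ensures.ite ?_).mono (by simp [cost])
    fun _ => id
  have htest : (BExp.eqR (.get 0 (.reg d)) (.lit 0)).eval m₁ =
      decide (w.reals.getD (a.eval w l) 0 = 0) := by
    simp only [BExp.eval, RExp.eval, NExp.eval, hx, (hm.keeps h₁).rarr_zero, Nat.cast_zero]
  rw [htest, eval]
  split_ifs with h0 h1 h1
  · exact .assignN ⟨h₁.setNat le_rfl _, Mem.setNat_nreg_self ..⟩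
  · exact absurd (of_decide_eq_true h0) h1
  · exact absurd (decide_eq_true h1) h0
  · exact .assignN ⟨h₁.setNat le_rfl _, Mem.setNat_nreg_self ..⟩

theorem Correct.bind (ha : a.Correct w) (hb : b.Correct w) : (bind a b).Correct w :=
  fun {_ _ d _} r hm => by
  refine ((ha r hm).seq (b := b.cost.eval w.size + 2) fun m₁ ⟨h₁, hx⟩ => ?_).mono
    (by simp [cost]; omega) fun _ => id
  refine (hb r (((hm.keeps h₁).mono d.le_succ).cons d.lt_succ_self hx)).seq
    fun m₂ ⟨h₂, hy⟩ => .assignN ⟨(h₁.trans (h₂.mono d.le_succ le_rfl)).setNat le_rfl _, ?_⟩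
  rw [Mem.setNat_nreg_self, NExp.eval, hy, eval]

theorem Correct.call (ha : a.Correct w) (θ : List ℕ) : (call θ a).Correct w :=
  fun r hm => ha r (hm.pick θ)

theorem Correct.ite (hc : c.Correct w) (ha : a.Correct w) (hb : b.Correct w) :
    (ite c a b).Correct w := fun {l _ d m} r hm => by
  refine ((hc r hm).seq (b := a.cost.eval w.size + b.cost.eval w.size + 1) fun m₁ ⟨h₁, hx⟩ =>
    Ensures.ite ?_).mono (by simp [cost]; omega) fun _ => id
  have htest : (BExp.eqN (.reg d) (.lit 0)).eval m₁ = decide (c.eval w l = 0) := by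
    rw [BExp.eval, NExp.eval, NExp.eval, hx]
  rw [htest, eval]
  by_cases h0 : c.eval w l = 0
  · simp only [h0, decide_true, if_true]
    exact (hb r (hm.keeps h₁)).mono (by omega) fun _ h => ⟨h₁.trans h.1, h.2⟩
  · simp only [h0, decide_false, Bool.false_eq_true, if_false]
    exact (ha r (hm.keeps h₁)).mono (by omega) fun _ h => ⟨h₁.trans h.1, h.2⟩

/-- The loops of `sum` and of `iter`: the register `d + 1` counts, and `d` accumulates. -/
theorem ensures_accumulate {body : Stmt} {B : ℕ} {f : ℕ → ℕ → ℕ} {l Γ : List ℕ} {d : ℕ} {m : Mem}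
    (r : ℕ) (hm : Frame w l Γ d m)
    (hbody : ∀ i m₁, Frame w l Γ d m₁ → m₁.nreg (d + 1) = i →
      Ensures body B
        (fun m₂ => Keeps d r m₁ m₂ ∧ m₂.nreg (d + 1) = i ∧ m₂.nreg d = f i (m₁.nreg d)) m₁) :
    Ensures (.seq (.assignN (d + 1) (.lit 0)) (forLoop (d + 1) body)) (w.size * (B + 3) + 3)
      (fun m' => Keeps d r m m' ∧
        m'.nreg d = Nat.rec (m.nreg d) (fun i y => f i y) w.size) m := by
  let Inv : ℕ → Mem → Prop := fun i m' => Keeps d r m m' ∧ m'.nreg (d + 1) = i ∧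
    m'.nreg d = Nat.rec (m.nreg d) (fun i y => f i y) i
  have hstart : Inv 0 (m.setNat (d + 1) 0) :=
    ⟨(Keeps.refl d r m).setNat d.le_succ 0, Mem.setNat_nreg_self ..,
      m.setNat_nreg_of_ne d.lt_succ_self.ne 0⟩
  refine (Ensures.seq (.assignN (Q := Inv 0) hstart) fun m₁ h₁ =>
    (Ensures.forLoop (Inv := Inv) (B := w.size) (c := B) ?_ ?_ ?_ h₁).mono le_rfl
      fun m₂ h => ⟨h.1, h.2.2⟩).mono (by omega) fun _ => id
  · exact fun i m' h => congrArg Word.size (hm.keeps h.1).input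
  · exact fun i m' h => h.2.1
  · intro i m' _ h
    refine (hbody i m' (hm.keeps h.1) h.2.1).mono le_rfl fun m₂ ⟨h₂, hi, hd⟩ =>
      ⟨(h.1.trans h₂).setNat d.le_succ _, ?_, ?_⟩
    · rw [Mem.setNat_nreg_self, hi]
    · rw [Mem.setNat_nreg_of_ne _ d.lt_succ_self.ne, hd, h.2.2]

theorem Correct.sum (ha : a.Correct w) : (sum a).Correct w := fun {l Γ d m} r hm => by
  refine (Ensures.seq (b := w.size * (a.cost.eval w.size + 5) + 3)
    (.assignN (Q := fun m₁ => Keeps d r m m₁ ∧ m₁.nreg d = 0)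
      ⟨(Keeps.refl d r m).setNat le_rfl 0, Mem.setNat_nreg_self ..⟩) fun m₁ ⟨h₁, hzero⟩ => ?_).mono
    (by simp [cost]; omega) fun _ => id
  refine (ensures_accumulate (f := fun i y => y + a.eval w (i :: l)) r (hm.keeps h₁) ?_).mono le_rfl
    fun m₂ ⟨h₂, hsum⟩ => ⟨h₁.trans h₂, ?_⟩
  · intro i m₂ hm₂ hi
    refine (ha r ((hm₂.mono (Nat.le_add_right d 2)).cons (by omega) hi)).seq
      fun m₃ ⟨h₃, hx⟩ => .assignN ?_
    refine ⟨(h₃.mono (Nat.le_add_right d 2) le_rfl).setNat le_rfl _, ?_, ?_⟩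
    · rw [Mem.setNat_nreg_of_ne _ d.succ_ne_self, h₃.nreg (Nat.lt_succ_self (d + 1)), hi]
    · rw [Mem.setNat_nreg_self, NExp.eval, NExp.eval, NExp.eval, hx,
        h₃.nreg (Nat.lt_add_of_pos_right two_pos)]
  · rw [hsum, hzero, eval]
    induction w.size with
    | zero => rfl
    | succ n ih => rw [Finset.sum_range_succ, ← ih]

theorem Correct.iter (ha : a.Correct w) (hb : b.Correct w) : (iter a b).Correct w :=
  fun {l Γ d m} r hm => by
  refine ((ha r hm).seq (b := w.size * (b.cost.eval w.size + 5) + 3) fun m₁ ⟨h₁, hx⟩ => ?_).mono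
    (by simp [cost]; omega) fun _ => id
  refine (ensures_accumulate (f := fun i y => b.eval w (y :: i :: l)) r (hm.keeps h₁) ?_).mono
    le_rfl fun m₂ ⟨h₂, hy⟩ => ⟨h₁.trans h₂, by rw [hy, hx, eval]⟩
  intro i m₂ hm₂ hi
  refine (hb r (((hm₂.mono (Nat.le_add_right d 2)).cons (by omega) hi).cons (by omega) rfl)).seq
    fun m₃ ⟨h₃, hy⟩ => .assignN ?_
  refine ⟨(h₃.mono (Nat.le_add_right d 2) le_rfl).setNat le_rfl _, ?_, ?_⟩
  · rw [Mem.setNat_nreg_of_ne _ d.succ_ne_self, h₃.nreg (Nat.lt_succ_self (d + 1)), hi]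
  · rw [Mem.setNat_nreg_self, NExp.eval, hy]

theorem correct (w : Word) (e : NTerm) : e.Correct w := by
  induction e with
  | lit n => exact correct_lit n
  | var j => exact correct_var j
  | add a b ha hb => exact ha.add hb
  | sub a b ha hb => exact ha.sub hb
  | mul a b ha hb => exact ha.mul hb
  | getN a ha => exact ha.getN
  | isZero a ha => exact ha.isZero
  | bind a b ha hb => exact ha.bind hb
  | call θ a ha => exact ha.call θ
  | ite c a b hc ha hb => exact hc.ite ha hb
  | sum a ha => exact ha.sum
  | iter a b ha hb => exact ha.iter hb

end NTerm

namespace RTerm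

/-- The code of a real term computes its value within the time given by its cost, and keeps all
registers that are in use. -/
def Correct (w : Word) (e : RTerm) : Prop :=
  ∀ {l Γ : List ℕ} {d : ℕ} {m : Mem} (r : ℕ), Frame w l Γ d m →
    Ensures (e.code Γ d r) (e.cost.eval w.size)
      (fun m' => Keeps d r m m' ∧ m'.rreg r = e.eval w l) m

variable {w : Word} {a b : RTerm} {c : NTerm}

theorem correct_lit (n : ℕ) : (lit n).Correct w := fun {_ _ d m} r _ =>
  Ensures.mono (.assignR ⟨(Keeps.refl d r m).setReal le_rfl n, m.setReal_rreg_self r n⟩)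
    (by simp only [cost, Polynomial.eval_one, le_refl]) fun _ => id

theorem correct_getR (i : NTerm) : (getR i).Correct w := fun r hm =>
  ((i.correct w r hm).seq fun m₁ ⟨h₁, hx⟩ => .assignR ⟨h₁.setReal le_rfl _, by
      rw [Mem.setReal_rreg_self, RExp.eval, NExp.eval, hx, (hm.keeps h₁).rarr_zero, eval]⟩).mono
    (by simp [cost]) fun _ => id

theorem Correct.binary {op : RExp → RExp → RExp} {f : ℝ → ℝ → ℝ}
    (hop : ∀ m x y, (op x y).eval m = f (x.eval m) (y.eval m)) (ha : a.Correct w)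
    (hb : b.Correct w) {l Γ : List ℕ} {d : ℕ} {m : Mem} (r : ℕ) (hm : Frame w l Γ d m) :
    Ensures
      (.seq (a.code Γ d r) (.seq (b.code Γ d (r + 1)) (.assignR r (op (.reg r) (.reg (r + 1))))))
      (a.cost.eval w.size + b.cost.eval w.size + 3)
      (fun m' => Keeps d r m m' ∧ m'.rreg r = f (a.eval w l) (b.eval w l)) m := by
  refine ((ha r hm).seq (b := b.cost.eval w.size + 2) fun m₁ ⟨h₁, hx⟩ => ?_).mono (by omega)
    fun _ => id
  refine (hb (r + 1) (hm.keeps h₁)).seq fun m₂ ⟨h₂, hy⟩ => .assignR ?_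
  refine ⟨(h₁.trans (h₂.mono le_rfl r.le_succ)).setReal le_rfl _, ?_⟩
  rw [Mem.setReal_rreg_self, hop, RExp.eval, RExp.eval, hy, h₂.rreg r.lt_succ_self, hx]

theorem Correct.add (ha : a.Correct w) (hb : b.Correct w) : (add a b).Correct w := fun r hm =>
  (ha.binary (fun _ _ _ => rfl) hb r hm).mono (by simp [cost]) fun _ => id

theorem Correct.mul (ha : a.Correct w) (hb : b.Correct w) : (mul a b).Correct w := fun r hm =>
  (ha.binary (fun _ _ _ => rfl) hb r hm).mono (by simp [cost]) fun _ => id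

theorem Correct.div (ha : a.Correct w) (hb : b.Correct w) : (div a b).Correct w := fun r hm =>
  (ha.binary (fun _ _ _ => rfl) hb r hm).mono (by simp [cost]) fun _ => id

theorem Correct.bind (c : NTerm) (ha : a.Correct w) : (bind c a).Correct w := fun {_ _ d _} r hm =>
  ((c.correct w r hm).seq fun m₁ ⟨h₁, hx⟩ =>
    (ha r (((hm.keeps h₁).mono d.le_succ).cons d.lt_succ_self hx)).mono le_rfl
      fun m₂ ⟨h₂, hy⟩ => ⟨h₁.trans (h₂.mono d.le_succ le_rfl), hy⟩).mono
    (by simp [cost]) fun _ => id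

theorem Correct.call (ha : a.Correct w) (θ : List ℕ) : (call θ a).Correct w :=
  fun r hm => ha r (hm.pick θ)

theorem Correct.ite (c : NTerm) (ha : a.Correct w) (hb : b.Correct w) : (ite c a b).Correct w :=
  fun {l _ d m} r hm => by
  refine ((c.correct w r hm).seq (b := a.cost.eval w.size + b.cost.eval w.size + 1)
    fun m₁ ⟨h₁, hx⟩ => Ensures.ite ?_).mono (by simp [cost]; omega) fun _ => id
  have htest : (BExp.eqN (.reg d) (.lit 0)).eval m₁ = decide (c.eval w l = 0) := by
    rw [BExp.eval, NExp.eval, NExp.eval, hx]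
  rw [htest, eval]
  by_cases h0 : c.eval w l = 0
  · simp only [h0, decide_true, if_true]
    exact (hb r (hm.keeps h₁)).mono (by omega) fun _ h => ⟨h₁.trans h.1, h.2⟩
  · simp only [h0, decide_false, Bool.false_eq_true, if_false]
    exact (ha r (hm.keeps h₁)).mono (by omega) fun _ h => ⟨h₁.trans h.1, h.2⟩

theorem Correct.prod (ha : a.Correct w) : (prod a).Correct w := fun {l Γ d m} r hm => by
  let Inv : ℕ → Mem → Prop := fun i m' => Keeps d r m m' ∧ m'.nreg d = i ∧
    m'.rreg r = ∏ j ∈ Finset.range i, a.eval w (j :: l)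
  have hstart : Inv 0 ((m.setReal r ((1 : ℕ) : ℝ)).setNat d 0) :=
    ⟨((Keeps.refl d r m).setReal le_rfl _).setNat le_rfl 0, Mem.setNat_nreg_self ..,
      (Mem.setReal_rreg_self ..).trans Nat.cast_one⟩
  have hloop : ∀ m₁, Inv 0 m₁ → Ensures (forLoop d (.seq (a.code (d :: Γ) (d + 1) (r + 1))
      (.assignR r (.mul (.reg r) (.reg (r + 1)))))) _ (Inv w.size) m₁ := fun m₁ =>
    Ensures.forLoop (c := a.cost.eval w.size + 2)
      (fun i m' h => congrArg Word.size (hm.keeps h.1).input) (fun i m' h => h.2.1) ?_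
  · refine (Ensures.seq (.assignR (Q := fun m₁ => Inv 0 (m₁.setNat d 0)) hstart)
      fun m₁ h₁ => (Ensures.assignN (Q := Inv 0) h₁).seq hloop).mono
        (by simp [cost]; ring_nf; omega) fun _ h => ⟨h.1, h.2.2⟩
  · intro i m₁ _ ⟨h₁, hi, hprod⟩
    refine (ha (r + 1) (((hm.keeps h₁).mono d.le_succ).cons d.lt_succ_self hi)).seq
      fun m₂ ⟨h₂, hx⟩ => .assignR ⟨?_, ?_, ?_⟩
    · exact ((h₁.trans (h₂.mono d.le_succ r.le_succ)).setReal le_rfl _).setNat le_rfl _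
    · exact (Mem.setNat_nreg_self ..).trans
        (congrArg (· + 1) ((h₂.nreg d.lt_succ_self).trans hi))
    · refine (Mem.setReal_rreg_self ..).trans ?_
      rw [RExp.eval, RExp.eval, RExp.eval, hx, h₂.rreg r.lt_succ_self, hprod,
        Finset.prod_range_succ]

theorem correct (w : Word) (e : RTerm) : e.Correct w := by
  induction e with
  | lit n => exact correct_lit n
  | getR i => exact correct_getR i
  | add a b ha hb => exact ha.add hb
  | mul a b ha hb => exact ha.mul hb
  | div a b ha hb => exact ha.div hb
  | bind c a ha => exact ha.bind c
  | call θ a ha => exact ha.call θ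
  | ite c a b ha hb => exact ha.ite c hb
  | prod a ha => exact ha.prod

end RTerm

/-- The word with the given entries. -/
def Word.ofEntries (L : List (ℕ ⊕ ℝ)) : Word :=
  ⟨L.filterMap Sum.getLeft?, L.filterMap Sum.getRight?⟩

/-- Append entries to the arrays with name `2`. -/
def Mem.emit (m : Mem) (L : List (ℕ ⊕ ℝ)) : Mem where
  nreg := m.nreg
  rreg := m.rreg
  narr := Function.update m.narr 2 (m.narr 2 ++ (Word.ofEntries L).nats)
  rarr := Function.update m.rarr 2 (m.rarr 2 ++ (Word.ofEntries L).reals)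

theorem Mem.emit_nil (m : Mem) : m.emit [] = m := by
  simp [emit, Word.ofEntries]

theorem Mem.emit_append (m : Mem) (L L' : List (ℕ ⊕ ℝ)) :
    m.emit (L ++ L') = (m.emit L).emit L' := by
  simp [emit, Word.ofEntries]

theorem Ensures.pushN {e : NExp} {Q : Mem → Prop} {m : Mem} (h : Q (m.emit [.inl (e.eval m)])) :
    Ensures (.pushN 2 e) 1 Q m := by
  refine ⟨_, .of_step (fun _ _ => ?_) (fun _ _ _ => Stmt.noConfusion), h⟩
  simp only [step, Mem.emit, Word.ofEntries, List.filterMap_cons, Sum.getLeft?_inl,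
    Sum.getRight?_inl, List.filterMap_nil, List.append_nil, Function.update_eq_self]

theorem Ensures.pushR {e : RExp} {Q : Mem → Prop} {m : Mem} (h : Q (m.emit [.inr (e.eval m)])) :
    Ensures (.pushR 2 e) 1 Q m := by
  refine ⟨_, .of_step (fun _ _ => ?_) (fun _ _ _ => Stmt.noConfusion), h⟩
  simp only [step, Mem.emit, Word.ofEntries, List.filterMap_cons, Sum.getLeft?_inr,
    Sum.getRight?_inr, List.filterMap_nil, List.append_nil, Function.update_eq_self]

theorem Keeps.emit {d r : ℕ} {m m' : Mem} (h : Keeps d r m m') (L : List (ℕ ⊕ ℝ)) :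
    Keeps d r (m.emit L) (m'.emit L) :=
  ⟨h.nreg, h.rreg, by simp only [Mem.emit, h.narr], by simp only [Mem.emit, h.rarr]⟩

theorem Frame.emit {w : Word} {l Γ : List ℕ} {d : ℕ} {m : Mem} (h : Frame w l Γ d m)
    (L : List (ℕ ⊕ ℝ)) : Frame w l Γ d (m.emit L) :=
  h.congr rfl (Set.eqOn_refl _ _)

namespace Cmd

/-- The code of a command appends the emitted numbers to the arrays with name `2` within the time
given by its cost, and keeps all registers that are in use. -/
def Correct (w : Word) (C : Cmd) : Prop :=
  ∀ {l Γ : List ℕ} {d : ℕ} {m : Mem}, Frame w l Γ d m →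
    Ensures (C.code Γ d) (C.cost.eval w.size) (Keeps d 1 (m.emit (C.out w l))) m

variable {w : Word} {A B : Cmd}

theorem correct_emitN (a : NTerm) : (emitN a).Correct w := fun hm =>
  ((a.correct w 1 hm).seq fun _ ⟨h₁, hx⟩ => .pushN (by
    rw [NExp.eval, hx]; exact h₁.emit _)).mono (by simp [cost]) fun _ => id

theorem correct_emitR (a : RTerm) : (emitR a).Correct w := fun hm =>
  ((a.correct w 1 hm).seq fun _ ⟨h₁, hx⟩ => .pushR (by
    rw [RExp.eval, hx]; exact h₁.emit _)).mono (by simp [cost]) fun _ => id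

theorem Correct.seq (hA : A.Correct w) (hB : B.Correct w) : (seq A B).Correct w :=
  fun {l _ _ m} hm =>
  ((hA hm).seq fun m₁ h₁ => (hB ((hm.emit _).keeps h₁)).mono le_rfl fun m₂ h₂ => by
    rw [out, m.emit_append]; exact (h₁.emit _).trans h₂).mono (by simp [cost]) fun _ => id

theorem Correct.guard (c : NTerm) (hA : A.Correct w) : (guard c A).Correct w :=
  fun {l _ d m} hm => by
  refine ((c.correct w 1 hm).seq (b := A.cost.eval w.size + 2) fun m₁ ⟨h₁, hx⟩ =>
    Ensures.ite ?_).mono (by simp [cost]; omega) fun _ => id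
  have htest : (BExp.eqN (.reg d) (.lit 0)).eval m₁ = decide (c.eval w l = 0) := by
    rw [BExp.eval, NExp.eval, NExp.eval, hx]
  rw [htest, out]
  by_cases h0 : c.eval w l = 0
  · simp only [h0, decide_true, if_true, m.emit_nil]
    exact (Ensures.skip (Q := Keeps d 1 m) h₁).mono (by omega) fun _ => id
  · simp only [h0, decide_false, Bool.false_eq_true, if_false]
    exact (hA (hm.keeps h₁)).mono (by omega) fun _ h => (h₁.emit _).trans h

theorem Correct.loop (hA : A.Correct w) : (loop A).Correct w := fun {l Γ d m} hm => by
  let emitted : ℕ → List (ℕ ⊕ ℝ) := fun i => (List.range i).flatMap fun j => A.out w (j :: l)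
  let Inv : ℕ → Mem → Prop := fun i m' => Keeps d 1 (m.emit (emitted i)) m' ∧ m'.nreg d = i
  have hstart : Inv 0 (m.setNat d 0) :=
    ⟨Keeps.setNat (by rw [show emitted 0 = [] from rfl, m.emit_nil]; exact .refl d 1 m) le_rfl 0,
      Mem.setNat_nreg_self ..⟩
  refine ((Ensures.assignN (Q := Inv 0) hstart).seq fun m₁ h₁ =>
    Ensures.forLoop (Inv := Inv) (B := w.size) (c := A.cost.eval w.size)
      (fun i m' h => congrArg Word.size ((hm.emit _).keeps h.1).input) (fun i m' h => h.2) ?_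
      h₁).mono (by simp [cost]; omega) fun _ h => h.1
  intro i m₁ _ ⟨h₁, hi⟩
  refine (hA ((((hm.emit _).keeps h₁).mono d.le_succ).cons d.lt_succ_self hi)).mono le_rfl
    fun m₂ h₂ => ⟨Keeps.setNat ?_ le_rfl _, ?_⟩
  · have hemitted : emitted (i + 1) = emitted i ++ A.out w (i :: l) := by
      simp only [emitted, List.range_succ, List.flatMap_append, List.flatMap_singleton]
    rw [hemitted, m.emit_append]
    exact (h₁.emit _).trans (h₂.mono d.le_succ le_rfl)
  · exact (Mem.setNat_nreg_self ..).trans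
      (congrArg (· + 1) ((h₂.nreg d.lt_succ_self).trans hi))

theorem correct (w : Word) (C : Cmd) : C.Correct w := by
  induction C with
  | emitN a => exact correct_emitN a
  | emitR a => exact correct_emitR a
  | seq A B hA hB => exact hA.seq hB
  | guard c A hA => exact hA.guard c
  | loop A hA => exact hA.loop

end Cmd

/-! ### Reductions that make a single oracle call -/

theorem run_halted (M : Oracle) (t : ℕ) (m : Mem) : run M t ⟨[], m⟩ = PMF.pure ⟨[], m⟩ := by
  induction t with
  | zero => rfl
  | succ t ih => rw [run, step, PMF.pure_bind, ih]

section Query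

variable (M : Oracle) (u q a : ℕ) (e : RExp) (m : Mem)

theorem run_query : run M (u + 1) ⟨[.query q a e], m⟩ =
    (M (m.word q) (e.eval m)).map fun v => ⟨[], m.load a v⟩ := by
  rw [run, step, PMF.bind_map]
  exact congrArg _ (funext fun v => run_halted M u _)

theorem eq_of_asks_of_mem_support_run_query {d : Cfg}
    (hd : d ∈ (run M u ⟨[.query q a e], m⟩).support) {w : Word} {δ : ℝ} (h : d.Asks w δ) :
    w = m.word q ∧ δ = e.eval m := by
  obtain ⟨q', a', e', k, hk, rfl, rfl⟩ := h
  cases u with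
  | zero =>
    obtain rfl : d = _ := by simpa only [run, PMF.mem_support_pure_iff] using hd
    obtain ⟨⟨rfl, rfl, rfl⟩, -⟩ : (q = q' ∧ a = a' ∧ e = e') ∧ [] = k := by
      simpa only [List.cons.injEq, Stmt.query.injEq] using hk
    exact ⟨rfl, rfl⟩
  | succ u =>
    rw [run_query, PMF.mem_support_map_iff] at hd
    obtain ⟨v, -, rfl⟩ := hd
    exact absurd hk (List.cons_ne_nil _ _).symm

end Query

namespace MaxProblem

theorem bound_X_one (P : MaxProblem) (x : P.Inst) (ε : ℝ) :
    P.bound (MvPolynomial.X 1) x ε = 1 / ε := by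
  simp [bound]

theorem bound_eval₂_X_zero (P : MaxProblem) (p : Polynomial ℕ) (x : P.Inst) (ε : ℝ) :
    P.bound (p.eval₂ (Nat.castRingHom _) (MvPolynomial.X 0)) x ε = (p.eval (P.size x) : ℕ) := by
  rw [bound, Polynomial.hom_eval₂, MvPolynomial.eval_X, Matrix.cons_val_zero,
    Subsingleton.elim (RingHom.comp _ _) (Nat.castRingHom ℝ)]
  exact Polynomial.eval₂_at_natCast ..

theorem APTReducible.of_translation {P Q : MaxProblem} (s : Stmt) (T : Polynomial ℕ)
    (translate : P.Inst → Q.Inst)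
    (hs : ∀ x ε, Ensures s (T.eval (P.size x))
      (fun m => m.word 2 = Q.encInst (translate x) ∧ m.rreg 0 = ε) (initCfg s (P.encInst x) ε).mem)
    (happrox : ∀ x (ε : ℝ), 0 < ε → ε < 1 → ∀ y : Q.Sol (translate x),
      Q.IsApprox (2 ^ ε) (translate x) y →
        ∃ y' : P.Sol x, P.encSol x y' = Q.encSol (translate x) y ∧ P.IsApprox (2 ^ ε) x y') :
    P.APTReducible Q := by
  refine ⟨.seq s (.query 2 1 (.reg 0)), .X 1,
    (T + 2).eval₂ (Nat.castRingHom _) (.X 0), fun M hM x ε hε hε1 => ?_⟩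
  obtain ⟨m, hexec, hword, hreg⟩ := hs x ε
  have hreach : Reaches (initCfg (.seq s (.query 2 1 (.reg 0))) (P.encInst x) ε)
      ⟨[.query 2 1 (.reg 0)], m⟩ (T.eval (P.size x) + 1) :=
    .head ⟨fun _ => rfl, fun _ _ ⟨_, _, _, _, h, _⟩ => nomatch h⟩ (hexec _)
  constructor
  · intro t c hc w δ hask
    obtain hnot | ⟨v, hv⟩ := hreach.not_asks_or_mem_support hc
    · exact absurd hask (hnot w δ)
    obtain ⟨rfl, rfl⟩ := eq_of_asks_of_mem_support_run_query M v 2 1 (.reg 0) m hv hask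
    rw [RExp.eval, hreg]
    exact ⟨⟨_, hword⟩, hε, hε1, (P.bound_X_one x ε).ge⟩
  obtain ⟨t, ht, hrun⟩ := hreach.run_eq M
  have hfinal : run M (t + 1) (initCfg (.seq s (.query 2 1 (.reg 0))) (P.encInst x) ε) =
      (M (Q.encInst (translate x)) ε).map fun v => ⟨[], m.load 1 v⟩ := by
    rw [hrun, run_query, hword, RExp.eval, hreg]
  refine ⟨t + 1, ?_, fun c hc => ?_, ?_⟩
  · rw [bound_eval₂_X_zero, Polynomial.eval_add, Polynomial.eval_ofNat]
    exact_mod_cast Nat.succ_le_succ ht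
  · rw [hfinal, PMF.mem_support_map_iff] at hc
    obtain ⟨v, -, rfl⟩ := hc
    rfl
  · have houtput : (Cfg.output ∘ fun v => ⟨[], m.load 1 v⟩) = id :=
      funext fun v => by simp [Cfg.output, Mem.word, Mem.load]
    rw [hfinal, PMF.map_comp, houtput, PMF.map_id]
    refine (hM (translate x) ε hε hε1).trans (MeasureTheory.measure_mono ?_)
    rintro v ⟨y, rfl, hy⟩
    exact happrox x ε hε hε1 y hy

theorem APTReducible.of_cmd {P Q : MaxProblem} (C : Cmd) (translate : P.Inst → Q.Inst)
    (hC : ∀ x, Word.ofEntries (C.out (P.encInst x) []) = Q.encInst (translate x))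
    (happrox : ∀ x (ε : ℝ), 0 < ε → ε < 1 → ∀ y : Q.Sol (translate x),
      Q.IsApprox (2 ^ ε) (translate x) y →
        ∃ y' : P.Sol x, P.encSol x y' = Q.encSol (translate x) y ∧ P.IsApprox (2 ^ ε) x y') :
    P.APTReducible Q := by
  refine .of_translation (C.code [] 1) C.cost translate (fun x ε => ?_) happrox
  have hframe : Frame (P.encInst x) [] [] 1 (initCfg (C.code [] 1) (P.encInst x) ε).mem :=
    ⟨by simp [initCfg, Mem.load, Mem.word], one_pos, rfl, nofun, rfl⟩
  refine (C.correct _ hframe).mono le_rfl fun m hm => ⟨?_, hm.rreg (Set.mem_Iio.2 one_pos)⟩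
  rw [hm.word_eq, ← hC]
  simp [Mem.word, Mem.emit, initCfg, Mem.load, Word.ofEntries]

end MaxProblem

/-! ### Products of unary constraints and implications -/

section Quadratic

variable {ι M : Type*} [CommMonoid M]

/-- The multiplicative analogue of a quadratic polynomial in the indicator of the finite set `S`. -/
def quadProd (c : M) (a : ι → M) (b : ι → ι → M) (S : Finset ι) : M :=
  c * (∏ p ∈ S, a p) * ∏ p ∈ S, ∏ q ∈ S, b p q

theorem quadProd_mul (c c' : M) (a a' : ι → M) (b b' : ι → ι → M) (S : Finset ι) :
    quadProd c a b S * quadProd c' a' b' S = quadProd (c * c') (a * a') (b * b') S := by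
  simp only [quadProd, Pi.mul_apply, Finset.prod_mul_distrib]
  ac_rfl

variable [DecidableEq ι] (c : M) (a : ι → M) (b : ι → ι → M) {S : Finset ι} {p q : ι}

theorem quadProd_insert (hp : p ∉ S) : quadProd c a b (insert p S) =
    a p * b p p * (∏ q ∈ S, b p q * b q p) * quadProd c a b S := by
  simp only [quadProd, Finset.prod_insert hp, Finset.prod_mul_distrib]
  ac_rfl

theorem quadProd_insert_insert_mul (hp : p ∉ insert q S) (hq : q ∉ S) :
    quadProd c a b (insert p (insert q S)) * quadProd c a b S =
      b p q * b q p * (quadProd c a b (insert p S) * quadProd c a b (insert q S)) := by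
  rw [quadProd_insert c a b hp, quadProd_insert c a b fun h => hp (Finset.mem_insert_of_mem h),
    Finset.prod_insert hq]
  ac_rfl

end Quadratic

section Structure

variable {ι : Type*} {f : (ι → Bool) → ℝ≥0} {p q r : ι}

/-- On the support of `f`, the variable `p` implies the variable `q`. -/
def Implies (f : (ι → Bool) → ℝ≥0) (p q : ι) : Prop := ∀ x, f x ≠ 0 → x p = true → x q = true

/-- The variable `p` takes the value `b` on the support of `f`. -/
def Takes (f : (ι → Bool) → ℝ≥0) (p : ι) (b : Bool) : Prop := ∃ x, f x ≠ 0 ∧ x p = b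

theorem Implies.refl (p : ι) : Implies f p p := fun _ _ => id

theorem Implies.trans (h : Implies f p q) (h' : Implies f q r) : Implies f p r :=
  fun x hx hp => h' x hx (h x hx hp)

theorem Implies.takes_true (h : Implies f p q) : Takes f p true → Takes f q true :=
  fun ⟨x, hx, hp⟩ => ⟨x, hx, h x hx hp⟩

theorem Implies.takes_false (h : Implies f p q) : Takes f q false → Takes f p false :=
  fun ⟨x, hx, hq⟩ => ⟨x, hx, Bool.eq_false_of_not_eq_true fun hp => by simp [h x hx hp] at hq⟩

theorem takes_true_of_not_implies (h : ¬ Implies f p q) : Takes f p true :=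
  by_contra fun h' => h fun x hx hp => absurd ⟨x, hx, hp⟩ h'

theorem takes_false_of_not_implies (h : ¬ Implies f p q) : Takes f q false :=
  by_contra fun h' => h fun x hx _ =>
    by_contra fun hq => h' ⟨x, hx, Bool.eq_false_of_not_eq_true hq⟩

variable [LinearOrder ι]

/-- The variable `p` is not constant on the support of `f`, and it is the first one in its class of
equivalent variables. -/
structure IsRep (f : (ι → Bool) → ℝ≥0) (p : ι) : Prop where
  takes_true : Takes f p true
  takes_false : Takes f p false
  first : ∀ q < p, ¬ (Implies f p q ∧ Implies f q p)

/-- A pair of incomparable representatives, in increasing order. -/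
structure Incomp (f : (ι → Bool) → ℝ≥0) (p q : ι) : Prop where
  lt : p < q
  left : IsRep f p
  right : IsRep f q
  not_implies : ¬ Implies f p q
  not_implies_symm : ¬ Implies f q p

theorem IsRep.eq (hp : IsRep f p) (hq : IsRep f q) (h : Implies f p q) (h' : Implies f q p) :
    p = q :=
  le_antisymm (not_lt.1 fun hlt => hp.first q hlt ⟨h, h'⟩)
    (not_lt.1 fun hlt => hq.first p hlt ⟨h', h⟩)

theorem exists_isRep [WellFoundedLT ι] (h : Takes f p true) (h' : Takes f p false) :
    ∃ r, IsRep f r ∧ Implies f p r ∧ Implies f r p := by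
  obtain ⟨r, ⟨hpr, hrp⟩, hmin⟩ := WellFounded.has_min (wellFounded_lt (α := ι))
    {r | Implies f p r ∧ Implies f r p} ⟨p, .refl p, .refl p⟩
  exact ⟨r, ⟨hpr.takes_true h, hrp.takes_false h',
    fun q hq hrq => hmin q ⟨hpr.trans hrq.1, hrq.2.trans hrp⟩ hq⟩, hpr, hrp⟩

variable [Fintype ι]

open Classical in
/-- The representatives that are true in `x`. -/
noncomputable def trueReps (f : (ι → Bool) → ℝ≥0) (x : ι → Bool) : Finset ι :=
  {p | IsRep f p ∧ x p = true}

theorem mem_trueReps {x : ι → Bool} : p ∈ trueReps f x ↔ IsRep f p ∧ x p = true := by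
  simp only [trueReps, Finset.mem_filter, Finset.mem_univ, true_and]

/-- On the support of `f`, the function `G` is the product of a constant `c`, of weights `a p` of
true representatives and of interactions `b p q ≥ 1` of true incomparable pairs. -/
structure HasCanonicalForm (f G : (ι → Bool) → ℝ≥0) (c : ℝ≥0) (a : ι → ℝ≥0) (b : ι → ι → ℝ≥0) :
    Prop where
  const_ne_zero : c ≠ 0
  one_le : ∀ p q, 1 ≤ b p q
  eq_one : ∀ p q, ¬ Incomp f p q → b p q = 1
  eq_quadProd : ∀ x, f x ≠ 0 → G x = quadProd c a b (trueReps f x)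

/-- Some `HasCanonicalForm` exists for `G`. -/
def Canonical (f G : (ι → Bool) → ℝ≥0) : Prop := ∃ c a b, HasCanonicalForm f G c a b

namespace Canonical

variable {G H : (ι → Bool) → ℝ≥0} {a b : ℝ≥0}

theorem congr (h : Canonical f G) (hGH : ∀ x, f x ≠ 0 → H x = G x) : Canonical f H :=
  let ⟨c, a, b, h⟩ := h
  ⟨c, a, b, h.1, h.2, h.3, fun x hx => (hGH x hx).trans (h.4 x hx)⟩

theorem mul : Canonical f G → Canonical f H → Canonical f (G * H) :=
  fun ⟨c, a, b, h⟩ ⟨c', a', b', h'⟩ => ⟨c * c', a * a', b * b',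
    mul_ne_zero h.1 h'.1, fun p q => one_le_mul (h.2 p q) (h'.2 p q),
    fun p q hpq => by rw [Pi.mul_apply, Pi.mul_apply, h.3 p q hpq, h'.3 p q hpq, one_mul],
    fun x hx => by rw [Pi.mul_apply, h.4 x hx, h'.4 x hx, quadProd_mul]⟩

theorem const (ha : a ≠ 0) : Canonical f fun _ => a :=
  ⟨a, 1, 1, ha, fun _ _ => le_rfl, fun _ _ _ => rfl, fun x _ => by simp [quadProd]⟩

variable (f) in
theorem single (ha : a ≠ 0) (i : ι) : Canonical f fun x => if x i = true then a else 1 := by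
  by_cases h₁ : Takes f i true
  swap
  · exact (const one_ne_zero).congr fun x hx => if_neg fun h => h₁ ⟨x, hx, h⟩
  by_cases h₀ : Takes f i false
  swap
  · exact (const ha).congr fun x hx =>
      if_pos (by_contra fun h => h₀ ⟨x, hx, Bool.eq_false_of_not_eq_true h⟩)
  obtain ⟨r, hr, hir, hri⟩ := exists_isRep h₁ h₀
  refine ⟨1, fun p => if p = r then a else 1, 1, one_ne_zero, fun _ _ => le_rfl, fun _ _ _ => rfl,
    fun x hx => ?_⟩
  have hxr : x i = true ↔ r ∈ trueReps f x := by
    rw [mem_trueReps]; exact ⟨fun h => ⟨hr, hir x hx h⟩, fun h => hri x hx h.2⟩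
  simp [quadProd, hxr, Finset.prod_ite_eq']

theorem of_incomp (hb : 1 ≤ b) (h : Incomp f p q) :
    Canonical f fun x => if x p = true ∧ x q = true then b else 1 := by
  refine ⟨1, 1, fun i j => if i = p then if j = q then b else 1 else 1, one_ne_zero,
    fun i j => ?_, fun i j hij => ?_, fun x _ => ?_⟩
  · split_ifs <;> simp [hb]
  · split_ifs with hi hj
    · exact absurd (hi ▸ hj ▸ h) hij
    all_goals rfl
  · have hp : p ∈ trueReps f x ↔ x p = true := by simp [mem_trueReps, h.left]
    have hq : q ∈ trueReps f x ↔ x q = true := by simp [mem_trueReps, h.right]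
    simp [quadProd, Finset.prod_ite_irrel, Finset.prod_ite_eq', hp, hq, ite_and]

variable (f) in
theorem pair (hb : 1 ≤ b) (i j : ι) :
    Canonical f fun x => if x i = true ∧ x j = true then b else 1 := by
  have hb0 : b ≠ 0 := (zero_lt_one.trans_le hb).ne'
  by_cases hij : Implies f i j
  · exact (single f hb0 i).congr fun x hx => if_congr (and_iff_left_of_imp (hij x hx)) rfl rfl
  by_cases hji : Implies f j i
  · exact (single f hb0 j).congr fun x hx => if_congr (and_iff_right_of_imp (hji x hx)) rfl rfl
  obtain ⟨r, hr, hir, hri⟩ :=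
    exists_isRep (takes_true_of_not_implies hij) (takes_false_of_not_implies hji)
  obtain ⟨s, hs, hjs, hsj⟩ :=
    exists_isRep (takes_true_of_not_implies hji) (takes_false_of_not_implies hij)
  have hrs : ¬ Implies f r s := fun h => hij ((hir.trans h).trans hsj)
  have hsr : ¬ Implies f s r := fun h => hji ((hjs.trans h).trans hri)
  have hxi : ∀ x, f x ≠ 0 → (x i = true ↔ x r = true) := fun x hx => ⟨hir x hx, hri x hx⟩
  have hxj : ∀ x, f x ≠ 0 → (x j = true ↔ x s = true) := fun x hx => ⟨hjs x hx, hsj x hx⟩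
  rcases lt_trichotomy r s with h | rfl | h
  · exact (of_incomp hb ⟨h, hr, hs, hrs, hsr⟩).congr fun x hx =>
      if_congr (and_congr (hxi x hx) (hxj x hx)) rfl rfl
  · exact absurd (.refl r) hrs
  · exact (of_incomp hb ⟨h, hs, hr, hsr, hrs⟩).congr fun x hx =>
      if_congr (and_comm.trans (and_congr (hxj x hx) (hxi x hx))) rfl rfl

end Canonical

end Structure

section Site

variable {ι κ : Type*}

/-- The places of a flow network on the vertices `ι` that carry a rate: the vertices themselves and
their ordered pairs. -/
abbrev Site (ι : Type*) := ι ⊕ ι × ι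

namespace Site

def map (φ : ι → κ) : Site ι → Site κ := Sum.map φ (Prod.map φ φ)

/-- The rate of the site contributes to the measure of the assignment. -/
def Active (x : ι → Bool) : Site ι → Prop
  | .inl q => x q = true
  | .inr (p, q) => x q ≤ x p

instance (x : ι → Bool) : DecidablePred (Active x)
  | .inl q => inferInstanceAs (Decidable (x q = true))
  | .inr (p, q) => inferInstanceAs (Decidable (x q ≤ x p))

theorem active_map {φ : ι → κ} {x : κ → Bool} :
    ∀ {l : Site ι}, Active x (map φ l) ↔ Active (x ∘ φ) l
  | .inl _ => Iff.rfl
  | .inr _ => Iff.rfl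

theorem prod_active [Fintype ι] {M : Type*} [CommMonoid M] (x : ι → Bool) (g : Site ι → M) :
    ∏ l with Active x l, g l =
      (∏ q with x q = true, g (.inl q)) * ∏ e : ι × ι with x e.2 ≤ x e.1, g (.inr e) := by
  simp only [Finset.prod_filter, Fintype.prod_sum_type]
  rfl

end Site

end Site

section ImProduct

variable {k : ℕ} {f : (Fin k → Bool) → ℝ≥0}

/-- The function `f` is a product of unary constraints and of constraints `(1, 1, lam, 1)`: the
condition that defines `IMopt`, on bare functions. -/
def IsImProduct (f : (Fin k → Bool) → ℝ≥0) : Prop :=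
  ∃ L : List (ImFactor k), ∀ x, f x = (L.map (ImFactor.eval x)).prod

theorem Canonical.factor (F : ImFactor k) (hF : ∀ x, f x ≠ 0 → F.eval x ≠ 0) :
    Canonical f fun x => F.eval x := by
  cases F with
  | unary i u =>
    let v : Bool → ℝ≥0 := fun b => if u b = 0 then 1 else u b
    have hv (b : Bool) : v b ≠ 0 := by
      dsimp only [v]
      split_ifs with h
      exacts [one_ne_zero, h]
    refine ((const (hv false)).mul
      (single f (div_ne_zero (hv true) (hv false)) i)).congr fun x hx => ?_
    have huv : u (x i) = v (x i) := (if_neg (hF x hx)).symm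
    rw [ImFactor.eval, huv]
    cases hi : x i <;> simp [hi, mul_div_cancel₀ _ (hv false)]
  | imp i j lam hlam =>
    by_cases h0 : lam = 0
    · refine (const one_ne_zero).congr fun x hx => if_neg fun h => hF x hx ?_
      rw [ImFactor.eval, if_pos h, h0]
    · have h1 : 1 ≤ lam⁻¹ := (one_le_inv₀ (pos_iff_ne_zero.2 h0)).2 hlam.le
      refine ((single f h0 i).mul (pair f h1 i j)).congr fun x _ => ?_
      cases hi : x i <;> cases hj : x j <;> simp [ImFactor.eval, hi, hj, h0]

theorem Canonical.prod_factors (L : List (ImFactor k))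
    (hL : ∀ F ∈ L, ∀ x, f x ≠ 0 → F.eval x ≠ 0) :
    Canonical f fun x => (L.map (ImFactor.eval x)).prod := by
  induction L with
  | nil => exact const one_ne_zero
  | cons F L ih =>
    simp only [List.map_cons, List.prod_cons]
    exact (factor F (hL F List.mem_cons_self)).mul
      (ih fun F' hF' => hL F' (List.mem_cons_of_mem _ hF'))

theorem prod_eval_ne_zero_iff {L : List (ImFactor k)} {x : Fin k → Bool} :
    (L.map (ImFactor.eval x)).prod ≠ 0 ↔ ∀ F ∈ L, F.eval x ≠ 0 := by
  simp [List.prod_eq_zero_iff]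

namespace IsImProduct

theorem canonical (hf : IsImProduct f) : Canonical f f := by
  obtain ⟨L, hL⟩ := hf
  refine (Canonical.prod_factors L fun F hF x hx => ?_).congr fun x _ => hL x
  exact prod_eval_ne_zero_iff.1 (hL x ▸ hx) F hF

theorem ne_zero_of_closed (hf : IsImProduct f) {x : Fin k → Bool}
    (himp : ∀ p q, Implies f p q → x p = true → x q = true) (htakes : ∀ p, Takes f p (x p)) :
    f x ≠ 0 := by
  obtain ⟨L, hL⟩ := hf
  have hfactor : ∀ y, f y ≠ 0 → ∀ F ∈ L, F.eval y ≠ 0 := fun y hy =>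
    prod_eval_ne_zero_iff.1 (hL y ▸ hy)
  rw [hL, prod_eval_ne_zero_iff]
  rintro (⟨i, u⟩ | ⟨i, j, lam, hlam⟩) hF
  · obtain ⟨y, hy, hyx⟩ := htakes i
    rw [ImFactor.eval, ← hyx]
    exact hfactor y hy _ hF
  · by_cases hij : Implies f i j
    · have : ¬ (x i = true ∧ x j = false) := fun h => by simp [himp i j hij h.1] at h
      simp [ImFactor.eval, this]
    · obtain ⟨y, hy, hi, hj⟩ : ∃ y, f y ≠ 0 ∧ y i = true ∧ y j = false := by
        simpa [Implies] using hij
      have : lam ≠ 0 := by simpa [ImFactor.eval, hi, hj] using hfactor y hy _ hF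
      rw [ImFactor.eval]
      split_ifs
      exacts [this, one_ne_zero]

end IsImProduct

open Classical in
/-- The indicator of the consequences of `p` and of `q`, from which the variables that imply `p`
(if `a`) and those that imply `q` (if `b`) are removed. -/
noncomputable def consequences (f : (Fin k → Bool) → ℝ≥0) (p q : Fin k) (a b : Bool) :
    Fin k → Bool := fun j =>
  decide ((Implies f p j ∨ Implies f q j) ∧ ¬ (a = true ∧ Implies f j p) ∧
    ¬ (b = true ∧ Implies f j q))

/-- The factor by which `f` changes when the representative `p` becomes true and nothing else
changes. -/
noncomputable def weight (f : (Fin k → Bool) → ℝ≥0) (p : Fin k) : ℝ≥0 :=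
  f (consequences f p p false false) / f (consequences f p p true true)

/-- The deviation of `f` from multiplicativity in an incomparable pair `p`, `q`. -/
noncomputable def interaction (f : (Fin k → Bool) → ℝ≥0) (p q : Fin k) : ℝ≥0 :=
  f (consequences f p q false false) * f (consequences f p q true true) /
    (f (consequences f p q true false) * f (consequences f p q false true))

variable {p q j : Fin k} {a b : Bool}

theorem consequences_eq_true :
    consequences f p q a b j = true ↔ (Implies f p j ∨ Implies f q j) ∧
      ¬ (a = true ∧ Implies f j p) ∧ ¬ (b = true ∧ Implies f j q) := by
  simp only [consequences, decide_eq_true_eq]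

theorem takes_consequences (hp : IsRep f p) (hq : IsRep f q) :
    Takes f j (consequences f p q a b j) := by
  cases h : consequences f p q a b j with
  | true => exact (consequences_eq_true.1 h).1.elim (·.takes_true hp.1) (·.takes_true hq.1)
  | false =>
    by_contra hj
    have hback (r : Fin k) : Implies f r j :=
      by_contra fun hr => hj (takes_false_of_not_implies hr)
    have htrue : consequences f p q a b j = true := consequences_eq_true.2
      ⟨.inl (hback p), fun h => hj (h.2.takes_false hp.2), fun h => hj (h.2.takes_false hq.2)⟩
    exact absurd htrue (by simp [h])

theorem IsImProduct.consequences_ne_zero (hf : IsImProduct f) (hp : IsRep f p) (hq : IsRep f q) :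
    f (consequences f p q a b) ≠ 0 := by
  refine hf.ne_zero_of_closed (fun i j hij hi => ?_) fun _ => takes_consequences hp hq
  rw [consequences_eq_true] at hi ⊢
  exact ⟨hi.1.imp (·.trans hij) (·.trans hij), fun h => hi.2.1 ⟨h.1, hij.trans h.2⟩,
    fun h => hi.2.2 ⟨h.1, hij.trans h.2⟩⟩

theorem mem_trueReps_consequences (hp : IsRep f p) (hq : IsRep f q)
    (hpq : Implies f p q → p = q ∧ a = b) (hqp : Implies f q p → p = q ∧ a = b) :
    j ∈ trueReps f (consequences f p q a b) ↔
      j = p ∧ a = false ∨ j = q ∧ b = false ∨ j ∈ trueReps f (consequences f p q true true) := by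
  have hpp := Implies.refl (f := f) p
  have hqq := Implies.refl (f := f) q
  have hj (r) : IsRep f r → IsRep f j → Implies f r j → Implies f j r → r = j := IsRep.eq
  have htrans (h : Implies f p j) : Implies f j q → Implies f p q := h.trans
  have htrans' (h : Implies f q j) : Implies f j p → Implies f q p := h.trans
  simp only [mem_trueReps, consequences_eq_true]
  grind

variable {c : ℝ≥0} {w : Fin k → ℝ≥0} {t : Fin k → Fin k → ℝ≥0}

theorem IsImProduct.weight_eq (hf : IsImProduct f) (h : HasCanonicalForm f f c w t)
    (hp : IsRep f p) : weight f p = w p := by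
  classical
  set x := consequences f p p false false
  set y := consequences f p p true true
  have hy : f y ≠ 0 := hf.consequences_ne_zero hp hp
  have hpy : p ∉ trueReps f y := fun hpy =>
    (consequences_eq_true.1 (mem_trueReps.1 hpy).2).2.1 ⟨rfl, .refl p⟩
  have hxy : trueReps f x = insert p (trueReps f y) := by
    ext j
    simp only [x, y, Finset.mem_insert]
    rw [mem_trueReps_consequences hp hp (fun _ => ⟨rfl, rfl⟩) fun _ => ⟨rfl, rfl⟩]
    tauto
  have ht : ∀ q ∈ trueReps f y, t p q * t q p = 1 := fun q hq => by
    have hpq : Implies f p q := (consequences_eq_true.1 (mem_trueReps.1 hq).2).1.elim id id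
    rw [h.eq_one p q fun hi => hi.not_implies hpq, h.eq_one q p fun hi => hi.not_implies_symm hpq,
      one_mul]
  have hfx : f x = w p * f y := by
    rw [h.eq_quadProd x (hf.consequences_ne_zero hp hp), h.eq_quadProd y hy, hxy,
      quadProd_insert _ _ _ hpy, Finset.prod_congr rfl ht, Finset.prod_const_one,
      h.eq_one p p fun hi => hi.lt.ne rfl, mul_one, mul_one]
  exact (congrArg (· / f y) hfx).trans (mul_div_cancel_right₀ _ hy)

theorem IsImProduct.interaction_eq (hf : IsImProduct f) (h : HasCanonicalForm f f c w t)
    (hpq : Incomp f p q) : interaction f p q = t p q := by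
  classical
  have hne (a b : Bool) : f (consequences f p q a b) ≠ 0 :=
    hf.consequences_ne_zero hpq.left hpq.right
  set S := trueReps f (consequences f p q true true) with hS
  have hmem {a b : Bool} {j : Fin k} : j ∈ trueReps f (consequences f p q a b) ↔
      j = p ∧ a = false ∨ j = q ∧ b = false ∨ j ∈ S :=
    mem_trueReps_consequences hpq.left hpq.right (fun h => absurd h hpq.not_implies)
      fun h => absurd h hpq.not_implies_symm
  have hpS : p ∉ S := fun hp => (consequences_eq_true.1 (mem_trueReps.1 hp).2).2.1 ⟨rfl, .refl p⟩
  have hqS : q ∉ S := fun hq => (consequences_eq_true.1 (mem_trueReps.1 hq).2).2.2 ⟨rfl, .refl q⟩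
  have hff : trueReps f (consequences f p q false false) = insert p (insert q S) := by
    ext j; simp [hmem]
  have hft : trueReps f (consequences f p q false true) = insert p S := by ext j; simp [hmem]
  have htf : trueReps f (consequences f p q true false) = insert q S := by ext j; simp [hmem]
  have hprod : f (consequences f p q false false) * f (consequences f p q true true) =
      t p q * (f (consequences f p q true false) * f (consequences f p q false true)) := by
    rw [h.eq_quadProd _ (hne false false), h.eq_quadProd _ (hne true true),
      h.eq_quadProd _ (hne true false), h.eq_quadProd _ (hne false true), hff, hft, htf, ← hS,
      quadProd_insert_insert_mul _ _ _ (by simp [hpq.lt.ne, hpS]) hqS,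
      h.eq_one q p fun hi => hi.lt.not_gt hpq.lt, mul_one, mul_comm (quadProd c w t (insert p S))]
  rw [interaction, hprod, mul_div_cancel_right₀ _ (mul_ne_zero (hne _ _) (hne _ _))]

open Classical in
/-- The flow rate contributed by the pair `p`, `q`. -/
noncomputable def edgeFactor (f : (Fin k → Bool) → ℝ≥0) (p q : Fin k) : ℝ≥0 :=
  if Incomp f p q then interaction f p q else 1

open Classical in
/-- The influx rate contributed by the variable `q`. The rate of the edge `(p, q)` is also collected
when `q` is false, hence the second factor. -/
noncomputable def vertexFactor (f : (Fin k → Bool) → ℝ≥0) (q : Fin k) : ℝ≥0 :=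
  (if Takes f q true then if IsRep f q then weight f q else 1 else 0) * ∏ p, edgeFactor f p q

theorem IsImProduct.edgeFactor_eq (hf : IsImProduct f) (h : HasCanonicalForm f f c w t) :
    edgeFactor f p q = t p q := by
  rw [edgeFactor]
  split_ifs with hpq
  exacts [hf.interaction_eq h hpq, (h.eq_one p q hpq).symm]

theorem IsImProduct.one_le_edgeFactor (hf : IsImProduct f) : 1 ≤ edgeFactor f p q := by
  obtain ⟨c, w, t, h⟩ := hf.canonical
  exact hf.edgeFactor_eq h ▸ h.one_le p q

theorem IsImProduct.prod_vertexFactor (hf : IsImProduct f) (h : HasCanonicalForm f f c w t)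
    {x : Fin k → Bool} (hx : f x ≠ 0) :
    ∏ q, (if x q = true then vertexFactor f q else 1) =
      (∏ q ∈ trueReps f x, w q) * ∏ p, ∏ q, if x q = true then t p q else 1 := by
  classical
  rw [Finset.prod_comm, trueReps, Finset.prod_filter, ← Finset.prod_mul_distrib]
  refine Finset.prod_congr rfl fun q _ => ?_
  by_cases hq : x q = true
  · have hq' : Takes f q true := ⟨x, hx, hq⟩
    simp only [hq, hq', if_true, and_true, vertexFactor, hf.edgeFactor_eq h]
    congr 1
    split_ifs with hr
    exacts [hf.weight_eq h hr, rfl]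
  · simp [hq]

theorem HasCanonicalForm.prod_prod_trueReps (h : HasCanonicalForm f f c w t) (x : Fin k → Bool) :
    ∏ p ∈ trueReps f x, ∏ q ∈ trueReps f x, t p q =
      ∏ p, ∏ q, if x p = true ∧ x q = true then t p q else 1 := by
  classical
  rw [← Fintype.prod_prod_type', ← Finset.prod_product']
  refine Finset.prod_congr_of_eq_on_inter (fun _ _ h => absurd (Finset.mem_univ _) h)
    (fun i _ hi => ite_eq_right_iff.2 fun hx => h.eq_one _ _ fun hi' => hi ?_) fun i hi _ => ?_
  · exact Finset.mem_product.2 ⟨mem_trueReps.2 ⟨hi'.left, hx.1⟩, mem_trueReps.2 ⟨hi'.right, hx.2⟩⟩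
  · obtain ⟨hp, hq⟩ := Finset.mem_product.1 hi
    exact (if_pos ⟨(mem_trueReps.1 hp).2, (mem_trueReps.1 hq).2⟩).symm

/-- The rate that `f` contributes to a site. -/
noncomputable def siteFactor (f : (Fin k → Bool) → ℝ≥0) : Site (Fin k) → ℝ≥0
  | .inl q => vertexFactor f q
  | .inr (p, q) => edgeFactor f p q

/-- The support of `f` requires the site to be active. -/
def Forced (f : (Fin k → Bool) → ℝ≥0) : Site (Fin k) → Prop
  | .inl q => ¬ Takes f q false
  | .inr (p, q) => Implies f q p

theorem Forced.active {x : Fin k → Bool} (hx : f x ≠ 0) :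
    ∀ {l : Site (Fin k)}, Forced f l → l.Active x
  | .inl _, h => by_contra fun hq => h ⟨x, hx, Bool.eq_false_of_not_eq_true hq⟩
  | .inr _, h => Bool.le_iff_imp.2 (h x hx)

theorem IsImProduct.exists_prod_siteFactor (hf : IsImProduct f) : ∃ c : ℝ≥0, c ≠ 0 ∧
    ∀ x, f x ≠ 0 → ∏ l with Site.Active x l, siteFactor f l = c * f x := by
  obtain ⟨c, w, t, h⟩ := hf.canonical
  have hsplit (x : Fin k → Bool) (p q : Fin k) :
      (if x q = true then t p q else 1) * (if x q ≤ x p then t p q else 1) =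
        t p q * if x p = true ∧ x q = true then t p q else 1 := by
    cases x p <;> cases x q <;> simp
  refine ⟨(∏ p, ∏ q, t p q) / c, div_ne_zero (Finset.prod_ne_zero_iff.2 fun p _ =>
    Finset.prod_ne_zero_iff.2 fun q _ => (zero_lt_one.trans_le (h.one_le p q)).ne')
      h.const_ne_zero, fun x hx => ?_⟩
  rw [Site.prod_active, Finset.prod_filter, Finset.prod_filter, Fintype.prod_prod_type]
  calc _ = (∏ q ∈ trueReps f x, w q) * ∏ p, ∏ q,
        (if x q = true then t p q else 1) * (if x q ≤ x p then t p q else 1) := by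
        simp only [siteFactor, hf.prod_vertexFactor h hx, hf.edgeFactor_eq h,
          Finset.prod_mul_distrib, mul_assoc]
    _ = (∏ p, ∏ q, t p q) / c * quadProd c w t (trueReps f x) := by
        simp only [hsplit, Finset.prod_mul_distrib, ← h.prod_prod_trueReps x, quadProd]
        have := h.const_ne_zero
        field_simp
    _ = _ := by rw [← h.eq_quadProd x hx]

theorem IsImProduct.ne_zero_iff (hf : IsImProduct f) {x : Fin k → Bool} : f x ≠ 0 ↔
    (∀ l, Forced f l → l.Active x) ∧ ∏ l with Site.Active x l, siteFactor f l ≠ 0 := by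
  refine ⟨fun hx => ⟨fun _ => Forced.active hx, ?_⟩, fun ⟨hforced, hprod⟩ => ?_⟩
  · obtain ⟨c, hc, h⟩ := hf.exists_prod_siteFactor
    exact h x hx ▸ mul_ne_zero hc hx
  refine hf.ne_zero_of_closed (fun p q hpq => Bool.le_iff_imp.1 (hforced (.inr (q, p)) hpq))
    fun p => by_contra fun hp => ?_
  cases hxp : x p with
  | false =>
    rw [hxp] at hp
    exact absurd (hforced (.inl p) hp) (ne_true_of_eq_false hxp)
  | true =>
    rw [hxp] at hp
    refine Finset.prod_ne_zero_iff.1 hprod (.inl p) (Finset.mem_filter_univ _ |>.2 hxp) ?_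
    simp [siteFactor, vertexFactor, hp]

end ImProduct

/-! ### Hard conditions enforced by a penalty -/

section Penalty

variable {S ι : Type*}

/-- Up to a constant factor, `fl` agrees with `m` wherever `m` does not vanish; and where `m`
vanishes, `fl` is at most half of each of the former values. -/
structure IsPenalized (m fl : S → ℝ≥0) : Prop where
  exists_eq_mul : ∃ C : ℝ≥0, C ≠ 0 ∧ ∀ σ, m σ ≠ 0 → fl σ = C * m σ
  two_mul_le : ∀ σ τ, m σ = 0 → m τ ≠ 0 → 2 * fl σ ≤ fl τ

theorem IsPenalized.ne_zero_of_lt {m fl : S → ℝ≥0} (h : IsPenalized m fl) {τ : S} (hτ : m τ ≠ 0)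
    {v : ℝ} (hv : fl τ ≤ v) {σ : S} (hσ : v < 2 * fl σ) : m σ ≠ 0 := fun h0 =>
  have : (2 * fl σ : ℝ) ≤ fl τ := mod_cast h.two_mul_le σ τ h0 hτ
  absurd hσ (this.trans hv).not_gt

theorem MaxProblem.isApprox_of_forall_measure_eq_zero {P : MaxProblem} {x : P.Inst}
    (h : ∀ σ, P.measure x σ = 0) (α : ℝ) (y : P.Sol x) : P.IsApprox α x y :=
  ⟨0, ⟨⟨y, h y⟩, Set.forall_mem_range.2 fun σ => (h σ).le⟩, fun _ => h y, fun h0 => absurd rfl h0⟩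

theorem lt_two_mul_of_one_div_le_div {a b α : ℝ} (hb : 0 < b) (hα0 : 0 < α) (hα : α < 2)
    (h : 1 / α ≤ a / b) : b < 2 * a := by
  rw [div_le_div_iff₀ hα0 hb, one_mul] at h
  have ha : 0 < a := pos_of_mul_pos_left (hb.trans_le h) hα0.le
  exact mul_comm a 2 ▸ h.trans_lt (mul_lt_mul_of_pos_left hα ha)

theorem IsPenalized.isApprox {P Q : MaxProblem} {x : P.Inst} {z : Q.Inst}
    {φ : P.Sol x ≃ Q.Sol z} {m fl : P.Sol x → ℝ≥0} (h : IsPenalized m fl)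
    (hm : ∀ σ, P.measure x σ = m σ) (hfl : ∀ σ, Q.measure z (φ σ) = fl σ)
    {α : ℝ} (hα0 : 0 < α) (hα : α < 2) {y : P.Sol x} (hy : Q.IsApprox α z (φ y)) :
    P.IsApprox α x y := by
  by_cases hall : ∀ σ, m σ = 0
  · exact P.isApprox_of_forall_measure_eq_zero (fun σ => by simp [hm, hall σ]) α y
  obtain ⟨τ, hτ⟩ := not_forall.1 hall
  obtain ⟨C, hC, hflC⟩ := h.exists_eq_mul
  obtain ⟨_, ⟨⟨y₀', rfl⟩, hmax⟩, -, happrox⟩ := hy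
  obtain ⟨y₀, rfl⟩ := φ.surjective y₀'
  have hle (σ : P.Sol x) : fl σ ≤ fl y₀ := by
    exact_mod_cast hfl σ ▸ hfl y₀ ▸ hmax (Set.mem_range_self (φ σ))
  have hpos : 0 < fl y₀ := (pos_iff_ne_zero.2 (hflC τ hτ ▸ mul_ne_zero hC hτ)).trans_le (hle τ)
  rw [hfl, hfl] at happrox
  obtain ⟨hlow, hup⟩ := happrox (NNReal.coe_ne_zero.2 hpos.ne')
  have hτle : (fl τ : ℝ) ≤ fl y₀ := mod_cast hle τ
  have hy₀ : m y₀ ≠ 0 := h.ne_zero_of_lt hτ hτle (by exact_mod_cast lt_two_mul_self hpos)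
  have hy : m y ≠ 0 := h.ne_zero_of_lt hτ hτle <|
    lt_two_mul_of_one_div_le_div (mod_cast hpos) hα0 hα
      (hlow.trans_eq (abs_of_nonneg (by positivity)))
  have hratio : (fl y : ℝ) / fl y₀ = m y / m y₀ := by
    rw [hflC y hy, hflC y₀ hy₀]
    push_cast
    exact mul_div_mul_left _ _ (NNReal.coe_ne_zero.2 hC)
  refine ⟨m y₀, ⟨⟨y₀, hm y₀⟩, Set.forall_mem_range.2 fun σ => ?_⟩,
    fun h0 => absurd h0 (NNReal.coe_ne_zero.2 hy₀), fun _ => ?_⟩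
  swap
  · rw [hm, ← hratio]
    exact ⟨hlow, hup⟩
  rw [hm, NNReal.coe_le_coe]
  by_cases hσ : m σ = 0
  · exact hσ ▸ zero_le
  · exact le_of_mul_le_mul_left (hflC y₀ hy₀ ▸ hflC σ hσ ▸ hle σ) (pos_iff_ne_zero.2 hC)

variable [Fintype ι]

/-- A number so large that a single factor of it makes up for any change of the set of those `ρ i`
that are multiplied. -/
noncomputable def penaltyFactor (ρ : ι → ℝ≥0) : ℝ≥0 := 2 * ∏ i, (1 + ρ i) * (1 + 1 / ρ i)

theorem one_le_penaltyFactor (ρ : ι → ℝ≥0) : 1 ≤ penaltyFactor ρ :=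
  one_le_mul one_le_two (Finset.one_le_prod' fun _ _ => one_le_mul (by simp) (by simp))

theorem two_mul_prod_le_penaltyFactor_mul_prod (ρ : ι → ℝ≥0) (A : Finset ι) {B : Finset ι}
    (hB : ∏ i ∈ B, ρ i ≠ 0) : 2 * ∏ i ∈ A, ρ i ≤ penaltyFactor ρ * ∏ i ∈ B, ρ i := by
  have hle (g : ι → ℝ≥0) (A : Finset ι) : ∏ i ∈ A, g i ≤ ∏ i, (1 + g i) :=
    (Finset.prod_le_prod' fun i _ => le_add_self).trans
      (Finset.prod_le_prod_of_subset_of_one_le' (Finset.subset_univ A) fun i _ _ => by simp)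
  have hinv : (∏ i ∈ B, 1 / ρ i) * ∏ i ∈ B, ρ i = 1 := by
    simp only [one_div, Finset.prod_inv_distrib, inv_mul_cancel₀ hB]
  calc 2 * ∏ i ∈ A, ρ i = 2 * (∏ i ∈ A, ρ i) * ((∏ i ∈ B, 1 / ρ i) * ∏ i ∈ B, ρ i) := by
        rw [hinv, mul_one]
    _ ≤ 2 * (∏ i, (1 + ρ i)) * ((∏ i, (1 + 1 / ρ i)) * ∏ i ∈ B, ρ i) := by
        gcongr <;> exact hle _ _
    _ = penaltyFactor ρ * ∏ i ∈ B, ρ i := by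
        rw [penaltyFactor, Finset.prod_mul_distrib]; ring

theorem isPenalized_of_hard [DecidableEq ι] {m : S → ℝ≥0} (act : S → Finset ι) (hard : Finset ι)
    (ρ : ι → ℝ≥0) {c : ℝ≥0} (hc : c ≠ 0) (hm : ∀ σ, m σ ≠ 0 → ∏ i ∈ act σ, ρ i = c * m σ)
    (hfeasible : ∀ σ, m σ ≠ 0 ↔ hard ⊆ act σ ∧ ∏ i ∈ act σ, ρ i ≠ 0) :
    IsPenalized m fun σ => ∏ i ∈ act σ, ρ i * if i ∈ hard then penaltyFactor ρ else 1 := by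
  set K := penaltyFactor ρ
  have hK : 1 ≤ K := one_le_penaltyFactor ρ
  have hfl (σ : S) : ∏ i ∈ act σ, ρ i * (if i ∈ hard then K else 1) =
      (∏ i ∈ act σ, ρ i) * K ^ (act σ ∩ hard).card := by
    rw [Finset.prod_mul_distrib, Finset.prod_ite_mem, Finset.prod_const]
  have hflm (σ : S) (hσ : m σ ≠ 0) : ∏ i ∈ act σ, ρ i * (if i ∈ hard then K else 1) =
      (∏ i ∈ act σ, ρ i) * K ^ hard.card := by
    rw [hfl, Finset.inter_eq_right.2 ((hfeasible σ).1 hσ).1]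
  refine ⟨⟨c * K ^ hard.card, mul_ne_zero hc (pow_ne_zero _ (zero_lt_one.trans_le hK).ne'),
    fun σ hσ => ?_⟩, fun σ τ hσ hτ => ?_⟩
  · rw [hflm σ hσ, hm σ hσ, mul_right_comm]
  rw [hflm τ hτ, hfl]
  by_cases hsub : hard ⊆ act σ
  · have hzero : ∏ i ∈ act σ, ρ i = 0 := by_contra fun h0 => (hfeasible σ).2 ⟨hsub, h0⟩ hσ
    simp [hzero]
  have hcard : (act σ ∩ hard).card + 1 ≤ hard.card :=
    Finset.card_lt_card (Finset.inter_subset_right.ssubset_of_ne (mt Finset.inter_eq_right.1 hsub))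
  calc 2 * ((∏ i ∈ act σ, ρ i) * K ^ (act σ ∩ hard).card)
      = (2 * ∏ i ∈ act σ, ρ i) * K ^ (act σ ∩ hard).card := (mul_assoc _ _ _).symm
    _ ≤ (K * ∏ i ∈ act τ, ρ i) * K ^ (act σ ∩ hard).card := by
        gcongr ?_ * _
        exact two_mul_prod_le_penaltyFactor_mul_prod ρ _ ((hfeasible τ).1 hτ).2
    _ = (∏ i ∈ act τ, ρ i) * K ^ ((act σ ∩ hard).card + 1) := by ring
    _ ≤ (∏ i ∈ act τ, ρ i) * K ^ hard.card := by gcongr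

end Penalty

/-! ### The flow instance of an instance of the constraint problem -/

namespace CSPInst

variable {F : Set Constraint} (x : CSPInst F)

/-- The function of the application `i`. -/
def fn (i : Fin x.apps.length) : (Fin (x.apps[i]).h.arity → Bool) → ℝ≥0 := (x.apps[i]).h.val

/-- The tuple of arguments of the application `i`. -/
def arg (i : Fin x.apps.length) : Fin (x.apps[i]).h.arity → Fin x.n := (x.apps[i]).args

/-- The rate of a site, without penalty. -/
noncomputable def softRate (l : Site (Fin x.n)) : ℝ≥0 :=
  ∏ i, ∏ l', if Site.map (x.arg i) l' = l then siteFactor (x.fn i) l' else 1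

open Classical in
/-- The sites that must be active for the measure of an assignment not to vanish. -/
noncomputable def hardSites : Finset (Site (Fin x.n)) :=
  {l | ∃ i l', Site.map (x.arg i) l' = l ∧ Forced (x.fn i) l'}

/-- The rate of a site in the flow network that encodes the instance. -/
noncomputable def rate (l : Site (Fin x.n)) : ℝ≥0 :=
  x.softRate l * if l ∈ x.hardSites then penaltyFactor x.softRate else 1

variable {x}

theorem mem_hardSites {l : Site (Fin x.n)} :
    l ∈ x.hardSites ↔ ∃ i l', Site.map (x.arg i) l' = l ∧ Forced (x.fn i) l' := by
  classical exact Finset.mem_filter_univ ..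

theorem hardSites_subset_iff {s : Finset (Site (Fin x.n))} :
    x.hardSites ⊆ s ↔ ∀ i l', Forced (x.fn i) l' → Site.map (x.arg i) l' ∈ s := by
  simp only [Finset.subset_iff, mem_hardSites]
  exact ⟨fun h i l' hl' => h ⟨i, l', rfl, hl'⟩, fun h l ⟨i, l', hl, hl'⟩ => hl ▸ h i l' hl'⟩

theorem isImProduct_fn (hF : F ⊆ IMopt) (i : Fin x.apps.length) : IsImProduct (x.fn i) :=
  hF (x.mem _ (List.getElem_mem i.2))

theorem one_le_softRate (hF : F ⊆ IMopt) (y z : Fin x.n) : 1 ≤ x.softRate (.inr (y, z)) := by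
  refine Finset.one_le_prod' fun i _ => Finset.one_le_prod' fun l' _ => ?_
  rcases l' with q | ⟨p, q⟩
  · simp [Site.map]
  · split_ifs
    exacts [(isImProduct_fn hF i).one_le_edgeFactor, le_rfl]

theorem one_le_rate (hF : F ⊆ IMopt) (y z : Fin x.n) : 1 ≤ x.rate (.inr (y, z)) := by
  refine one_le_mul (one_le_softRate hF y z) ?_
  split_ifs
  exacts [one_le_penaltyFactor _, le_rfl]

variable (x)

/-- The complete directed graph with the rates `CSPInst.rate`. -/
noncomputable def toFlow (hF : F ⊆ IMopt) : FlowInst where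
  n := x.n
  edges := (List.finRange x.n ×ˢ List.finRange x.n).map fun e => (e, (x.rate (.inr e) : ℝ))
  nodup := by
    simpa [Function.comp_def] using (List.nodup_finRange x.n).product (List.nodup_finRange x.n)
  one_le e he := by
    obtain ⟨⟨y, z⟩, -, rfl⟩ := List.mem_map.1 he
    exact mod_cast one_le_rate hF y z
  influx z := x.rate (.inl z)

theorem toFlow_measure (hF : F ⊆ IMopt) (σ : Fin x.n → Bool) :
    maxProdFlow.measure (x.toFlow hF) σ = (∏ l with Site.Active σ l, x.rate l : ℝ≥0) := by
  have hedges : (((x.toFlow hF).edges.filter fun e => decide (σ e.1.1 ≥ σ e.1.2)).map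
      Prod.snd).prod = ∏ e : Fin x.n × Fin x.n with σ e.2 ≤ σ e.1, (x.rate (.inr e) : ℝ) := by
    simp only [toFlow, List.filter_map, List.map_map]
    have hnodup := (List.nodup_finRange x.n).product (List.nodup_finRange x.n)
    refine (List.prod_toFinset _ (hnodup.filter _)).symm.trans
      (Finset.prod_congr ?_ fun _ _ => rfl)
    ext ⟨y, z⟩
    simp
  rw [Site.prod_active, mul_comm, NNReal.coe_mul, NNReal.coe_prod, NNReal.coe_prod, ← hedges]
  rfl

variable {x}

theorem prod_softRate (σ : Fin x.n → Bool) : ∏ l with Site.Active σ l, x.softRate l =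
    ∏ i, ∏ l' with Site.Active (σ ∘ x.arg i) l', siteFactor (x.fn i) l' := by
  simp only [softRate]
  rw [Finset.prod_comm]
  refine Finset.prod_congr rfl fun i _ => ?_
  rw [Finset.prod_comm, Finset.prod_filter]
  refine Finset.prod_congr rfl fun l' _ => ?_
  simp only [Finset.prod_ite_eq, Finset.mem_filter_univ, Site.active_map]

/-- The product of the constraints as a nonnegative real number. -/
noncomputable def value (x : CSPInst F) (σ : Fin x.n → Bool) : ℝ≥0 := ∏ i, x.fn i (σ ∘ x.arg i)

theorem measure_eq (σ : Fin x.n → Bool) : (maxProdCSP F).measure x σ = x.value σ :=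
  congrArg NNReal.toReal (Fin.prod_univ_fun_getElem x.apps fun a => a.h.val (σ ∘ a.args)).symm

theorem isPenalized (hF : F ⊆ IMopt) :
    IsPenalized x.value fun σ => ∏ l with Site.Active σ l, x.rate l := by
  have him (i : Fin x.apps.length) : IsImProduct (x.fn i) := isImProduct_fn hF i
  choose c hc hprod using fun i => (him i).exists_prod_siteFactor
  refine isPenalized_of_hard _ x.hardSites x.softRate (c := ∏ i, c i)
    (Finset.prod_ne_zero_iff.2 fun i _ => hc i) (fun σ hσ => ?_) fun σ => ?_
  · rw [prod_softRate, value, ← Finset.prod_mul_distrib]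
    exact Finset.prod_congr rfl fun i hi => hprod i _ (Finset.prod_ne_zero_iff.1 hσ i hi)
  · simp only [value, prod_softRate, Finset.prod_ne_zero_iff (s := Finset.univ (α := Fin _)),
      Finset.mem_univ, true_imp_iff, (him _).ne_zero_iff, hardSites_subset_iff,
      Finset.mem_filter_univ, Site.active_map, forall_and]

theorem isApprox_of_toFlow (hF : F ⊆ IMopt) {ε : ℝ} (hε : ε < 1) (σ : Fin x.n → Bool)
    (h : maxProdFlow.IsApprox (2 ^ ε) (x.toFlow hF) σ) : (maxProdCSP F).IsApprox (2 ^ ε) x σ := by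
  have hα : (2 : ℝ) ^ ε < 2 := by
    simpa using Real.rpow_lt_rpow_of_exponent_lt one_lt_two hε
  exact (isPenalized hF).isApprox (P := maxProdCSP F) (Q := maxProdFlow) (x := x)
    (z := x.toFlow hF) (φ := Equiv.refl (Fin x.n → Bool)) measure_eq (x.toFlow_measure hF)
    (Real.rpow_pos_of_pos two_pos ε) hα h

end CSPInst

/-! ### Value tables -/

/-- The position of an argument in the lexicographic order. -/
def tableIndex {k : ℕ} (x : Fin k → Bool) : ℕ :=
  ∑ j : Fin k, if x j then 2 ^ (k - 1 - j : ℕ) else 0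

theorem ofBits_eq_sum {k : ℕ} (x : Fin k → Bool) :
    Nat.ofBits x = ∑ j : Fin k, if x j then 2 ^ (j : ℕ) else 0 := by
  induction k with
  | zero => simp
  | succ k ih =>
    rw [Nat.ofBits_succ, ih, Fin.sum_univ_succ, Finset.mul_sum, Nat.add_comm]
    congr 1
    · cases x 0 <;> rfl
    · simp only [Function.comp_apply, mul_ite, mul_zero, Fin.val_succ, pow_succ']

theorem tableIndex_eq_ofBits {k : ℕ} (x : Fin k → Bool) :
    tableIndex x = Nat.ofBits (x ∘ Fin.rev) := by
  rw [ofBits_eq_sum, tableIndex, ← Equiv.sum_comp Fin.revPerm]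
  refine Finset.sum_congr rfl fun j _ => ?_
  simp only [Fin.revPerm_apply, Function.comp_apply, Fin.val_rev]
  congr 2
  lia

theorem tableIndex_lt {k : ℕ} (x : Fin k → Bool) : tableIndex x < 2 ^ k :=
  tableIndex_eq_ofBits x ▸ Nat.ofBits_lt_two_pow _

theorem testBit_tableIndex {k : ℕ} (x : Fin k → Bool) (j : Fin k) :
    (tableIndex x).testBit (k - 1 - j) = x j := by
  rw [tableIndex_eq_ofBits, Nat.testBit_ofBits_lt _ _ (by lia), Function.comp_apply]
  congr 1
  ext
  simp only [Fin.val_rev]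
  lia

theorem exists_tableIndex_eq {k t : ℕ} (ht : t < 2 ^ k) : ∃ x : Fin k → Bool, tableIndex x = t := by
  refine ⟨fun j => t.testBit j.rev, ?_⟩
  simp only [tableIndex_eq_ofBits, Function.comp_def, Fin.rev_rev, Nat.ofBits_testBit,
    Nat.mod_eq_of_lt ht]

theorem tableIndex_cons {k : ℕ} (b : Bool) (x : Fin k → Bool) :
    tableIndex (Fin.cons b x : Fin (k + 1) → Bool) = (if b then 2 ^ k else 0) + tableIndex x := by
  simp only [tableIndex, Fin.sum_univ_succ, Fin.cons_zero, Fin.cons_succ, Fin.val_zero,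
    Fin.val_succ, Nat.add_sub_cancel, Nat.sub_zero, Nat.sub_sub, Nat.add_comm 1]

theorem length_table (k : ℕ) (f : (Fin k → Bool) → ℝ≥0) : (table k f).length = 2 ^ k := by
  induction k with
  | zero => rfl
  | succ k ih => rw [table, List.length_append, ih, ih, pow_succ, mul_two]

theorem getD_table {k : ℕ} (f : (Fin k → Bool) → ℝ≥0) (x : Fin k → Bool) :
    (table k f).getD (tableIndex x) 0 = f x := by
  induction x using Fin.consInduction with
  | elim0 => rfl
  | cons b x ih =>
    rw [tableIndex_cons, table]
    cases b with
    | false =>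
      have hx := (tableIndex_lt x).trans_eq (length_table _ fun x => f (Fin.cons false x)).symm
      simpa only [Bool.false_eq_true, if_false, Nat.zero_add, List.getD_append _ _ _ _ hx]
        using ih fun x => f (Fin.cons false x)
    | true =>
      rw [List.getD_append_right _ _ _ _ (by simp [length_table])]
      simpa [length_table] using ih fun x => f (Fin.cons true x)

/-! ### Tests and bounded iteration -/

/-- The value of the term is not zero. -/
def NTerm.Holds (w : Word) (e : NTerm) (l : List ℕ) : Prop := e.eval w l ≠ 0

@[to_additive]
theorem prod_range_ite_lt {M : Type*} [CommMonoid M] {n m : ℕ} (h : n ≤ m) (g : ℕ → M) :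
    (∏ i ∈ Finset.range m, if i < n then g i else 1) = ∏ i : Fin n, g i := by
  rw [← Finset.prod_filter, ← Finset.prod_range]
  congr 1
  ext i
  simp only [Finset.mem_filter, Finset.mem_range]
  lia

theorem flatMap_range_ite_lt {α : Type*} {n m : ℕ} (h : n ≤ m) (g : ℕ → List α) :
    ((List.range m).flatMap fun i => if i < n then g i else []) =
      (List.finRange n).flatMap fun i : Fin n => g i := by
  obtain ⟨d, rfl⟩ := Nat.exists_eq_add_of_le h
  rw [List.range_add, List.flatMap_append, List.flatMap_map, ← List.map_coe_finRange_eq_range,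
    List.flatMap_map]
  simp [List.flatMap_eq_nil_iff]

namespace NTerm

/-- The test `a < b`, with value `0` or `1`. -/
def lt (a b : NTerm) : NTerm := .sub (.lit 1) (.sub (.add a (.lit 1)) b)

/-- The test `a = b`. -/
def eq (a b : NTerm) : NTerm := .sub (.lit 1) (.add (.sub a b) (.sub b a))

/-- The negation of a test. -/
def not (a : NTerm) : NTerm := .sub (.lit 1) a

/-- The sum of the values of `a` for `i < n`, and, as a test, the existential quantifier. The term
`n` is evaluated in the environment of `a`, where `i` is the first variable. -/
def sumBelow (n a : NTerm) : NTerm := .sum (.mul (.lt (.var 0) n) a)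

/-- The result of `n` iterations of `b`, starting from `a`. The first two variables of `b` are the
current value and the number of iterations done, and `n` is evaluated in the environment of `b`. -/
def iterBelow (n a b : NTerm) : NTerm := .iter a (.ite (.lt (.var 1) n) b (.var 0))

variable {w : Word} {l : List ℕ} {a b c n : NTerm} {B : ℕ}

theorem eval_lt : (lt a b).eval w l = if a.eval w l < b.eval w l then 1 else 0 := by
  simp only [lt, eval]
  split_ifs <;> lia

theorem holds_eq : (eq a b).Holds w l ↔ a.eval w l = b.eval w l := by
  simp only [Holds, eq, eval]
  lia

theorem holds_lt : (lt a b).Holds w l ↔ a.eval w l < b.eval w l := by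
  simp [Holds, eval_lt]

theorem holds_not : (not a).Holds w l ↔ ¬ a.Holds w l := by
  simp only [Holds, not, eval]
  lia

theorem holds_mul : (mul a b).Holds w l ↔ a.Holds w l ∧ b.Holds w l := mul_ne_zero_iff

theorem holds_add : (add a b).Holds w l ↔ a.Holds w l ∨ b.Holds w l := by
  simp only [Holds, eval]
  lia

theorem holds_isZero : (isZero a).Holds w l ↔ w.reals.getD (a.eval w l) 0 = 0 := by
  simp [Holds, eval]

theorem eval_ite {P : Prop} [Decidable P] (h : c.Holds w l ↔ P) :
    (ite c a b).eval w l = if P then a.eval w l else b.eval w l := by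
  simp only [eval, ← h, Holds, ite_not]

theorem eval_sumBelow (hn : ∀ i, n.eval w (i :: l) = B) (hB : B ≤ w.size) :
    (sumBelow n a).eval w l = ∑ i : Fin B, a.eval w (i :: l) := by
  rw [← sum_range_ite_lt hB fun i => a.eval w (i :: l)]
  simp [sumBelow, eval, eval_lt, hn]

theorem holds_sumBelow (hn : ∀ i, n.eval w (i :: l) = B) (hB : B ≤ w.size) :
    (sumBelow n a).Holds w l ↔ ∃ i : Fin B, a.Holds w (i :: l) := by
  simp [Holds, eval_sumBelow hn hB]

theorem eval_iterBelow {g : ℕ → ℕ} (hn : ∀ y i, n.eval w (y :: i :: l) = B) (hB : B ≤ w.size)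
    (h_zero : a.eval w l = g 0) (h_succ : ∀ i < B, b.eval w (g i :: i :: l) = g (i + 1)) :
    (iterBelow n a b).eval w l = g B := by
  have hrec (i : ℕ) : Nat.rec (motive := fun _ => ℕ) (a.eval w l) (fun i y =>
      (NTerm.ite (.lt (.var 1) n) b (.var 0)).eval w (y :: i :: l)) i = g (min i B) := by
    induction i with
    | zero => simpa using h_zero
    | succ i ih =>
      dsimp only
      rw [ih, eval_ite holds_lt, hn]
      simp only [eval, List.getD_cons_zero, List.getD_cons_succ]
      split_ifs with hi
      · rw [min_eq_left hi.le, min_eq_left (by lia : i + 1 ≤ B), h_succ i hi]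
      · rw [min_eq_right (by lia : B ≤ i), min_eq_right (by lia : B ≤ i + 1)]
  exact (hrec w.size).trans (by rw [min_eq_right hB])

end NTerm

namespace RTerm

/-- The product of the values of `a` for `i < n`, with the conventions of `NTerm.sumBelow`. -/
def prodBelow (n : NTerm) (a : RTerm) : RTerm := .prod (.ite (.lt (.var 0) n) a (.lit 1))

variable {w : Word} {l : List ℕ} {c n : NTerm} {a b : RTerm} {B : ℕ}

theorem eval_ite {P : Prop} [Decidable P] (h : c.Holds w l ↔ P) :
    (ite c a b).eval w l = if P then a.eval w l else b.eval w l := by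
  simp only [eval, ← h, NTerm.Holds, ite_not]

theorem eval_lit_one : (lit 1).eval w l = 1 := Nat.cast_one

theorem eval_prodBelow (hn : ∀ i, n.eval w (i :: l) = B) (hB : B ≤ w.size) :
    (prodBelow n a).eval w l = ∏ i : Fin B, a.eval w (i :: l) := by
  rw [← prod_range_ite_lt hB fun i => a.eval w (i :: l)]
  refine Finset.prod_congr rfl fun i _ => ?_
  rw [eval_ite NTerm.holds_lt, hn, eval_lit_one]
  rfl

end RTerm

namespace Cmd

/-- The command `a` for all `i < n`, with the conventions of `NTerm.sumBelow`. -/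
def loopBelow (n : NTerm) (a : Cmd) : Cmd := .loop (.guard (.lt (.var 0) n) a)

theorem out_guard {w : Word} {l : List ℕ} {c : NTerm} {a : Cmd} {P : Prop} [Decidable P]
    (h : c.Holds w l ↔ P) : (guard c a).out w l = if P then a.out w l else [] := by
  simp only [out, ← h, NTerm.Holds, ite_not]

theorem out_loopBelow {w : Word} {l : List ℕ} {n : NTerm} {a : Cmd} {B : ℕ}
    (hn : ∀ i, n.eval w (i :: l) = B) (hB : B ≤ w.size) :
    (loopBelow n a).out w l = (List.finRange B).flatMap fun i : Fin B => a.out w (i :: l) := by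
  rw [← flatMap_range_ite_lt hB fun i => a.out w (i :: l)]
  refine List.flatMap_congr fun i _ => ?_
  rw [out_guard NTerm.holds_lt, hn]
  rfl

end Cmd

/-! ### Terms for the factors of a constraint -/

theorem testBit_iff_exists_fin {t e : ℕ} : t.testBit e = true ↔
    ∃ h : Fin t, (2 * h + 1) * 2 ^ e ≤ t ∧ t < (2 * h + 2) * 2 ^ e := by
  have hpos : 0 < 2 ^ e := by positivity
  have hdiv (h : ℕ) : (2 * h + 1) * 2 ^ e ≤ t ∧ t < (2 * h + 2) * 2 ^ e ↔
      t / 2 ^ e = 2 * h + 1 := by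
    rw [← Nat.le_div_iff_mul_le hpos, ← Nat.div_lt_iff_lt_mul hpos]
    lia
  simp only [Nat.testBit_eq_decide_div_mod_eq, decide_eq_true_iff, hdiv]
  have hle : t / 2 ^ e ≤ t := Nat.div_le_self ..
  exact ⟨fun h => ⟨⟨t / 2 ^ e / 2, by lia⟩, by lia⟩, fun ⟨h, hh⟩ => by lia⟩

section ConstraintTerms

open NTerm

/-- The power `2 ^ e`, in an environment that starts with `e`. -/
def powTerm : NTerm := .iterBelow (.var 2) (.lit 1) (.add (.var 0) (.var 0))

/-- The bit of `t` with weight `2 ^ (k - 1 - j)`, in the environment `[t, j, k]`. -/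
def bitTerm : NTerm :=
  .bind (.sub (.sub (.var 2) (.lit 1)) (.var 1)) <| .bind powTerm <| .sumBelow (.var 3) <|
    .mul (.not (.lt (.var 3) (.mul (.add (.mul (.lit 2) (.var 0)) (.lit 1)) (.var 1))))
      (.lt (.var 3) (.mul (.add (.mul (.lit 2) (.var 0)) (.lit 2)) (.var 1)))

/-- Whether `a` holds for some `t < 2 ^ k` such that the entry `o + t` of the input is nonzero. The
first variable of `k`, `o` and `a` is `t`. -/
def someSupp (k o a : NTerm) : NTerm :=
  .sumBelow (.bind k powTerm) (.mul (.not (.isZero (.add o (.var 0)))) a)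

/-- The test `Takes f p b`, in the environment `[p, k, o]`. -/
def takesTerm (b : Bool) : NTerm :=
  someSupp (.var 2) (.var 3)
    (if b then .call [0, 1, 2] bitTerm else .not (.call [0, 1, 2] bitTerm))

/-- The test `Implies f p q`, in the environment `[p, q, k, o]`. -/
def impliesTerm : NTerm :=
  .not (someSupp (.var 3) (.var 4)
    (.mul (.call [0, 1, 3] bitTerm) (.not (.call [0, 2, 3] bitTerm))))

/-- The test `IsRep f p`, in the environment `[p, k, o]`. -/
def isRepTerm : NTerm :=
  .mul (takesTerm true) (.mul (takesTerm false) (.not (.sumBelow (.var 1)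
    (.mul (.call [1, 0, 2, 3] impliesTerm) (.call [0, 1, 2, 3] impliesTerm)))))

/-- The test `Incomp f p q`, in the environment `[p, q, k, o]`. -/
def incompTerm : NTerm :=
  .mul (.lt (.var 0) (.var 1)) (.mul (.call [0, 2, 3] isRepTerm) (.mul (.call [1, 2, 3] isRepTerm)
    (.mul (.not impliesTerm) (.not (.call [1, 0, 2, 3] impliesTerm)))))

/-- The test `consequences f p q a b j = true`, in the environment `[j, p, q, k, o]`. -/
def consequencesTerm (a b : Bool) : NTerm :=
  .mul (.add (.call [1, 0, 3, 4] impliesTerm) (.call [2, 0, 3, 4] impliesTerm))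
    (.mul (.not (.mul (.lit a.toNat) (.call [0, 1, 3, 4] impliesTerm)))
      (.not (.mul (.lit b.toNat) (.call [0, 2, 3, 4] impliesTerm))))

/-- The value `f (consequences f p q a b)`, in the environment `[p, q, k, o]`. -/
def valueTerm (a b : Bool) : RTerm :=
  .getR (.add (.var 3) (.sumBelow (.var 3) (.ite (consequencesTerm a b)
    (.bind (.sub (.sub (.var 3) (.lit 1)) (.var 0)) powTerm) (.lit 0))))

/-- The rate `edgeFactor f p q`, in the environment `[p, q, k, o]`. -/
def edgeTerm : RTerm :=
  .ite incompTerm (.div (.mul (valueTerm false false) (valueTerm true true))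
    (.mul (valueTerm true false) (valueTerm false true))) (.lit 1)

/-- The rate `vertexFactor f q`, in the environment `[q, k, o]`. -/
def vertexTerm : RTerm :=
  .mul (.ite (takesTerm true) (.ite isRepTerm
      (.call [0, 0, 1, 2] (.div (valueTerm false false) (valueTerm true true))) (.lit 1)) (.lit 0))
    (.prodBelow (.var 2) edgeTerm)

/-- The real part of the word, which is at least as long as the table of `f`, has that table at the
position `o`. -/
structure TableAt (w : Word) {k : ℕ} (f : (Fin k → Bool) → ℝ≥0) (o : ℕ) : Prop where
  pow_le : 2 ^ k ≤ w.size
  getD_eq : ∀ x, w.reals.getD (o + tableIndex x) 0 = f x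

variable {w : Word}

theorem eval_powTerm {e : ℕ} {l : List ℕ} (he : e ≤ w.size) : powTerm.eval w (e :: l) = 2 ^ e :=
  eval_iterBelow (g := fun i => 2 ^ i) (fun _ _ => rfl) he rfl fun i _ => by
    rw [pow_succ, mul_two]
    rfl

theorem holds_bitTerm {t j k : ℕ} (hk : k ≤ w.size) (ht : t ≤ w.size) :
    bitTerm.Holds w [t, j, k] ↔ t.testBit (k - 1 - j) = true := by
  have hpow : powTerm.eval w [k - 1 - j, t, j, k] = 2 ^ (k - 1 - j) := eval_powTerm (by lia)
  have hbit : bitTerm.Holds w [t, j, k] ↔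
      ∃ h : Fin t, ¬ t < (2 * h + 1) * powTerm.eval w [k - 1 - j, t, j, k] ∧
        t < (2 * h + 2) * powTerm.eval w [k - 1 - j, t, j, k] :=
    (holds_sumBelow (fun _ => rfl) ht).trans <| exists_congr fun h =>
      holds_mul.trans (and_congr (holds_not.trans (not_congr holds_lt)) holds_lt)
  simp only [hbit, hpow, testBit_iff_exists_fin, not_lt]

namespace TableAt

variable {k o : ℕ} {f : (Fin k → Bool) → ℝ≥0}

theorem arity_le (h : TableAt w f o) : k ≤ w.size := (Nat.lt_two_pow_self.trans_le h.pow_le).le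

theorem holds_someSupp (h : TableAt w f o) {l : List ℕ} {K O a : NTerm}
    (hK : ∀ t, K.eval w (t :: l) = k) (hO : ∀ t, O.eval w (t :: l) = o) :
    (someSupp K O a).Holds w l ↔ ∃ x, f x ≠ 0 ∧ a.Holds w (tableIndex x :: l) := by
  have hpow (t : ℕ) : (NTerm.bind K powTerm).eval w (t :: l) = 2 ^ k := by
    rw [NTerm.eval, hK, eval_powTerm h.arity_le]
  have hentry (x : Fin k → Bool) :
      (NTerm.not (.isZero (.add O (.var 0)))).Holds w (tableIndex x :: l) ↔ f x ≠ 0 := by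
    simp only [holds_not, holds_isZero, NTerm.eval, hO, List.getD_cons_zero, h.getD_eq, ne_eq,
      NNReal.coe_eq_zero]
  simp only [someSupp, holds_sumBelow hpow h.pow_le, holds_mul]
  constructor
  · rintro ⟨⟨t, ht⟩, hsupp, ha⟩
    obtain ⟨x, rfl⟩ := exists_tableIndex_eq ht
    exact ⟨x, (hentry x).1 hsupp, ha⟩
  · rintro ⟨x, hx, ha⟩
    exact ⟨⟨tableIndex x, tableIndex_lt x⟩, (hentry x).2 hx, ha⟩

theorem holds_bitTerm (h : TableAt w f o) (x : Fin k → Bool) (j : Fin k) :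
    bitTerm.Holds w [tableIndex x, j, k] ↔ x j = true := by
  rw [ProdCSP.holds_bitTerm h.arity_le ((tableIndex_lt x).le.trans h.pow_le), testBit_tableIndex]

theorem holds_takesTerm (h : TableAt w f o) (p : Fin k) (b : Bool) :
    (takesTerm b).Holds w [p, k, o] ↔ Takes f p b :=
  (h.holds_someSupp (fun _ => rfl) fun _ => rfl).trans <| exists_congr fun x =>
    and_congr_right fun _ => by
      cases b with
      | true => exact h.holds_bitTerm x p
      | false => exact holds_not.trans ((not_congr (h.holds_bitTerm x p)).trans (by simp))

theorem holds_impliesTerm (h : TableAt w f o) (p q : Fin k) :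
    impliesTerm.Holds w [p, q, k, o] ↔ Implies f p q := by
  have hsupp : impliesTerm.Holds w [p, q, k, o] ↔
      ¬ ∃ x, f x ≠ 0 ∧ x p = true ∧ ¬ x q = true :=
    holds_not.trans <| not_congr <| (h.holds_someSupp (fun _ => rfl) fun _ => rfl).trans <|
      exists_congr fun x => and_congr_right fun _ => holds_mul.trans <|
        and_congr (h.holds_bitTerm x p) (holds_not.trans (not_congr (h.holds_bitTerm x q)))
  rw [hsupp]
  push Not
  rfl

theorem holds_isRepTerm (h : TableAt w f o) (p : Fin k) :
    isRepTerm.Holds w [p, k, o] ↔ IsRep f p := by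
  have hfirst : (NTerm.not (.sumBelow (.var 1) (.mul (.call [1, 0, 2, 3] impliesTerm)
      (.call [0, 1, 2, 3] impliesTerm)))).Holds w [p, k, o] ↔
        ∀ q < p, ¬ (Implies f p q ∧ Implies f q p) := by
    have hbelow := holds_sumBelow (w := w) (l := [p, k, o]) (n := .var 1) (B := p)
      (a := .mul (.call [1, 0, 2, 3] impliesTerm) (.call [0, 1, 2, 3] impliesTerm))
      (fun _ => rfl) (p.isLt.le.trans h.arity_le)
    rw [holds_not, hbelow, not_exists]
    refine ⟨fun hn q hq hpq => hn ⟨q, hq⟩ (holds_mul.2 ?_), fun hn q hq => ?_⟩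
    · exact ⟨(h.holds_impliesTerm p q).2 hpq.1, (h.holds_impliesTerm q p).2 hpq.2⟩
    · let q' : Fin k := ⟨q, q.isLt.trans p.isLt⟩
      exact hn q' q.isLt ⟨(h.holds_impliesTerm p q').1 (holds_mul.1 hq).1,
        (h.holds_impliesTerm q' p).1 (holds_mul.1 hq).2⟩
  rw [isRepTerm, holds_mul, holds_mul, h.holds_takesTerm, h.holds_takesTerm, hfirst]
  exact ⟨fun ⟨h₁, h₂, h₃⟩ => ⟨h₁, h₂, h₃⟩, fun h => ⟨h.1, h.2, h.3⟩⟩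

theorem holds_incompTerm (h : TableAt w f o) (p q : Fin k) :
    incompTerm.Holds w [p, q, k, o] ↔ Incomp f p q := by
  have hlt : (NTerm.lt (.var 0) (.var 1)).Holds w [p, q, k, o] ↔ p < q := holds_lt
  have hp : (NTerm.call [0, 2, 3] isRepTerm).Holds w [p, q, k, o] ↔ _ := h.holds_isRepTerm p
  have hq : (NTerm.call [1, 2, 3] isRepTerm).Holds w [p, q, k, o] ↔ _ := h.holds_isRepTerm q
  have hqp : (NTerm.call [1, 0, 2, 3] impliesTerm).Holds w [p, q, k, o] ↔ _ :=
    h.holds_impliesTerm q p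
  simp only [incompTerm, holds_mul, holds_not, hlt, hp, hq, h.holds_impliesTerm p q, hqp]
  exact ⟨fun ⟨h₁, h₂, h₃, h₄, h₅⟩ => ⟨h₁, h₂, h₃, h₄, h₅⟩, fun h => ⟨h.1, h.2, h.3, h.4, h.5⟩⟩

theorem holds_consequencesTerm (h : TableAt w f o) (j p q : Fin k) (a b : Bool) :
    (consequencesTerm a b).Holds w [j, p, q, k, o] ↔ consequences f p q a b j = true := by
  have hlit (b : Bool) : (NTerm.lit b.toNat).Holds w [j, p, q, k, o] ↔ b = true :=
    Bool.toNat_eq_zero.not.trans (iff_of_eq (Bool.not_eq_false b))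
  simp only [consequencesTerm, holds_mul, holds_not, holds_add, hlit, consequences_eq_true]
  exact and_congr (or_congr (h.holds_impliesTerm p j) (h.holds_impliesTerm q j)) <|
    and_congr (not_congr (and_congr_right fun _ => h.holds_impliesTerm j p))
      (not_congr (and_congr_right fun _ => h.holds_impliesTerm j q))

theorem eval_valueTerm (h : TableAt w f o) (p q : Fin k) (a b : Bool) :
    (valueTerm a b).eval w [p, q, k, o] = f (consequences f p q a b) := by
  rw [← h.getD_eq, valueTerm, RTerm.eval, NTerm.eval,
    eval_sumBelow (B := k) (fun _ => rfl) h.arity_le]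
  congr 2
  refine Finset.sum_congr rfl fun j _ => ?_
  rw [eval_ite (h.holds_consequencesTerm j p q a b)]
  congr 1
  exact eval_powTerm ((Nat.sub_le ..).trans ((Nat.sub_le ..).trans h.arity_le))

theorem eval_edgeTerm (h : TableAt w f o) (p q : Fin k) :
    edgeTerm.eval w [p, q, k, o] = edgeFactor f p q := by
  classical
  rw [edgeTerm, RTerm.eval_ite (h.holds_incompTerm p q), edgeFactor]
  split_ifs
  · simp only [RTerm.eval, h.eval_valueTerm, interaction, NNReal.coe_div, NNReal.coe_mul]
  · exact RTerm.eval_lit_one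

theorem eval_vertexTerm (h : TableAt w f o) (q : Fin k) :
    vertexTerm.eval w [q, k, o] = vertexFactor f q := by
  classical
  have hweight : (RTerm.call [0, 0, 1, 2] (.div (valueTerm false false)
      (valueTerm true true))).eval w [q, k, o] = weight f q := by
    rw [weight, NNReal.coe_div, ← h.eval_valueTerm, ← h.eval_valueTerm]
    rfl
  rw [vertexTerm, RTerm.eval, RTerm.eval_ite (h.holds_takesTerm q true),
    RTerm.eval_ite (h.holds_isRepTerm q), hweight, vertexFactor, NNReal.coe_mul, NNReal.coe_prod,
    RTerm.eval_prodBelow (B := k) (fun _ => rfl) h.arity_le]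
  congr 1
  · simp only [RTerm.eval, apply_ite NNReal.toReal, Nat.cast_one, Nat.cast_zero, NNReal.coe_one,
      NNReal.coe_zero]
  · exact Finset.prod_congr rfl fun p _ => h.eval_edgeTerm p q

end TableAt

end ConstraintTerms

/-! ### Reading an encoded instance -/

theorem getD_flatMap {α β : Type*} (L : List α) (g : α → List β) (i : Fin L.length) {j : ℕ}
    (hj : j < (g L[i]).length) (b : β) :
    (L.flatMap g).getD (((L.take i).flatMap g).length + j) b = (g L[i]).getD j b := by
  have hL : L.flatMap g = (L.take i).flatMap g ++ (g L[i] ++ (L.drop (i + 1)).flatMap g) := by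
    rw [← List.flatMap_cons, ← List.flatMap_append, Fin.getElem_fin, List.getElem_cons_drop,
      List.take_append_drop]
  rw [hL, List.getD_append_right _ _ _ _ (Nat.le_add_right ..), Nat.add_sub_cancel_left,
    List.getD_append _ _ _ _ hj]

theorem length_flatMap_take_succ {α β : Type*} (L : List α) (g : α → List β) (i : Fin L.length) :
    ((L.take (i + 1)).flatMap g).length = ((L.take i).flatMap g).length + (g L[i]).length := by
  rw [List.take_succ_eq_append_getElem i.2]
  simp

/-- The natural numbers that represent an application. -/
def Application.entries {n : ℕ} (a : Application n) : List ℕ :=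
  a.h.arity :: List.ofFn fun j => (a.args j : ℕ)

namespace CSPInst

variable {F : Set Constraint} (x : CSPInst F)

/-- The position in the natural-number part at which the application `i` starts. -/
def natPos (i : ℕ) : ℕ := x.n + 2 + ((x.apps.take i).flatMap Application.entries).length

/-- The position in the real part at which the table of the application `i` starts. -/
def realPos (i : ℕ) : ℕ :=
  ((x.apps.take i).flatMap fun a => table a.h.arity a.h.val).length

theorem getD_nats_length : x.enc.nats.getD (x.n + 1) 0 = x.apps.length := by
  rw [enc, List.getD_cons_succ, List.getD_append_right _ _ _ _ (by simp)]
  simp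

theorem getD_nats_natPos_add (i : Fin x.apps.length) {j : ℕ} (hj : j < (x.apps[i]).h.arity + 1) :
    x.enc.nats.getD (x.natPos i + j) 0 = (x.apps[i]).entries.getD j 0 := by
  have hpos : x.natPos i + j =
      x.n + (((x.apps.take i).flatMap Application.entries).length + j + 1) + 1 := by
    rw [natPos]
    ring
  rw [← getD_flatMap x.apps Application.entries i (by simpa [Application.entries] using hj), enc,
    hpos, List.getD_cons_succ, List.getD_append_right _ _ _ _ (by simp), List.length_range,
    Nat.add_sub_cancel_left, List.getD_cons_succ]
  rfl

theorem getD_nats_natPos (i : Fin x.apps.length) :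
    x.enc.nats.getD (x.natPos i) 0 = (x.apps[i]).h.arity :=
  x.getD_nats_natPos_add i (Nat.succ_pos _)

theorem getD_nats_arg (i : Fin x.apps.length) (q : Fin (x.apps[i]).h.arity) :
    x.enc.nats.getD (x.natPos i + 1 + q) 0 = x.arg i q := by
  rw [Nat.add_assoc, x.getD_nats_natPos_add i (by lia), Nat.add_comm 1, Application.entries,
    List.getD_cons_succ, List.getD_eq_getElem _ _ (by simp), List.getElem_ofFn]
  rfl

theorem natPos_succ (i : Fin x.apps.length) :
    x.natPos (i + 1) = x.natPos i + 1 + (x.apps[i]).h.arity := by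
  rw [natPos, natPos, length_flatMap_take_succ, Application.entries, List.length_cons,
    List.length_ofFn]
  ring

theorem realPos_succ (i : Fin x.apps.length) :
    x.realPos (i + 1) = x.realPos i + 2 ^ (x.apps[i]).h.arity := by
  rw [realPos, realPos, length_flatMap_take_succ, length_table]

theorem n_le_size : x.n ≤ x.enc.size := by
  simp only [Word.size, enc, List.length_cons, List.length_append, List.length_range]
  lia

theorem length_apps_le_size : x.apps.length ≤ x.enc.size := by
  have hle : x.apps.length ≤ (x.apps.flatMap Application.entries).length := by
    rw [List.length_flatMap]
    exact List.length_map (as := x.apps) _ ▸ List.length_le_sum_of_one_le _ (by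
      simp [Application.entries])
  refine hle.trans ?_
  simp only [Word.size, enc, List.length_cons, List.length_append]
  exact le_add_right (le_add_right (le_add_left (Nat.le_succ _)))

theorem tableAt (i : Fin x.apps.length) : TableAt x.enc (x.fn i) (x.realPos i) where
  pow_le := by
    rw [← length_table _ (x.fn i), Word.size, enc, List.length_flatMap]
    exact le_add_left (List.le_sum_of_mem
      (List.mem_map.2 ⟨x.apps[i], List.getElem_mem i.2, rfl⟩))
  getD_eq y := by
    rw [fn, ← getD_table, realPos, enc]
    exact getD_flatMap x.apps (fun a => table a.h.arity a.h.val) i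
      ((tableIndex_lt y).trans_eq (length_table ..).symm) 0

end CSPInst

/-! ### The command that emits the flow instance -/

section InstanceTerms

open NTerm

/-- The number of variables of the instance. -/
def sizeTerm : NTerm := .getN (.lit 0)

/-- The number of applications of the instance. -/
def numAppsTerm : NTerm := .getN (.add sizeTerm (.lit 1))

/-- The position `CSPInst.natPos i`, in an environment that starts with `i`. -/
def natPosTerm : NTerm :=
  .iterBelow (.var 2) (.add sizeTerm (.lit 2)) (.add (.add (.var 0) (.lit 1)) (.getN (.var 0)))

/-- The position `CSPInst.realPos i`, in an environment that starts with `i`. -/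
def realPosTerm : NTerm :=
  .iterBelow (.var 2) (.lit 0) (.add (.var 0) (.bind (.getN (.call [1] natPosTerm)) powTerm))

/-- The term `b` with `o`, `k` and `s` put in front of an environment that starts with `i`, where
`k` is the arity of the application `i`, and `o` and `s` are the positions of its table and of its
entries. -/
def NTerm.withApp (b : NTerm) : NTerm :=
  .bind (.call [0] natPosTerm) (.bind (.getN (.var 0)) (.bind (.call [2] realPosTerm) b))

/-- The real term `b` in the environment of `NTerm.withApp`. -/
def RTerm.withApp (b : RTerm) : RTerm :=
  .bind (.call [0] natPosTerm) (.bind (.getN (.var 0)) (.bind (.call [2] realPosTerm) b))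

/-- The test that the argument `q` of the application with entries at `s` is `z`. -/
def argEq (s q z : NTerm) : NTerm := .eq (.getN (.add (.add s (.lit 1)) q)) z

/-- The rate `softRate (.inl z)`, in the environment `[z]`. -/
def softInfluxTerm : RTerm :=
  .prodBelow numAppsTerm <| .withApp <| .prodBelow (.var 2) <|
    .ite (argEq (.var 3) (.var 0) (.var 5)) (.call [0, 2, 1] vertexTerm) (.lit 1)

/-- The rate `softRate (.inr (y, z))`, in the environment `[y, z]`. -/
def softFlowTerm : RTerm :=
  .prodBelow numAppsTerm <| .withApp <| .prodBelow (.var 2) <| .prodBelow (.var 3) <|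
    .ite (.mul (argEq (.var 4) (.var 1) (.var 6)) (argEq (.var 4) (.var 0) (.var 7)))
      (.call [1, 0, 3, 2] edgeTerm) (.lit 1)

/-- The test `.inl z ∈ hardSites`, in the environment `[z]`. -/
def hardVertexTerm : NTerm :=
  .sumBelow numAppsTerm <| .withApp <| .sumBelow (.var 2) <|
    .mul (argEq (.var 3) (.var 0) (.var 5)) (.not (.call [0, 2, 1] (takesTerm false)))

/-- The test `.inr (y, z) ∈ hardSites`, in the environment `[y, z]`. -/
def hardEdgeTerm : NTerm :=
  .sumBelow numAppsTerm <| .withApp <| .sumBelow (.var 2) <| .sumBelow (.var 3) <|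
    .mul (.mul (argEq (.var 4) (.var 1) (.var 6)) (argEq (.var 4) (.var 0) (.var 7)))
      (.call [0, 1, 3, 2] impliesTerm)

/-- The factor of `penaltyFactor` that comes from a rate. -/
def spreadTerm (a : RTerm) : RTerm := .mul (.add (.lit 1) a) (.add (.lit 1) (.div (.lit 1) a))

/-- The penalty `penaltyFactor softRate`, in any environment. -/
def penaltyTerm : RTerm :=
  .mul (.lit 2) <| .mul (.prodBelow sizeTerm (spreadTerm (.call [0] softInfluxTerm)))
    (.prodBelow sizeTerm (.prodBelow sizeTerm (spreadTerm (.call [1, 0] softFlowTerm))))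

/-- The rate `rate (.inl z)`, in the environment `[z]`. -/
def influxTerm : RTerm := .mul softInfluxTerm (.ite hardVertexTerm penaltyTerm (.lit 1))

/-- The rate `rate (.inr (y, z))`, in the environment `[y, z]`. -/
def flowTerm : RTerm := .mul softFlowTerm (.ite hardEdgeTerm penaltyTerm (.lit 1))

/-- The command that emits the encoding of the flow instance `CSPInst.toFlow`. -/
def flowCmd : Cmd :=
  .seq (.seq (.emitN sizeTerm) (.emitN (.mul sizeTerm sizeTerm))) <|
    .seq (.loopBelow sizeTerm (.loopBelow sizeTerm (.seq (.emitN (.var 1)) (.emitN (.var 0))))) <|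
      .seq (.loopBelow sizeTerm (.emitR (.call [0] influxTerm)))
        (.loopBelow sizeTerm (.loopBelow sizeTerm (.emitR (.call [1, 0] flowTerm))))

namespace CSPInst

variable {F : Set Constraint} (x : CSPInst F)

theorem softRate_inl (z : Fin x.n) : x.softRate (.inl z) =
    ∏ i, ∏ q, if x.arg i q = z then vertexFactor (x.fn i) q else 1 := by
  simp [softRate, Fintype.prod_sum_type, Site.map, siteFactor]

theorem softRate_inr (y z : Fin x.n) : x.softRate (.inr (y, z)) =
    ∏ i, ∏ p, ∏ q, if x.arg i p = y ∧ x.arg i q = z then edgeFactor (x.fn i) p q else 1 := by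
  simp [softRate, Fintype.prod_sum_type, Fintype.prod_prod_type, Site.map, siteFactor]

theorem inl_mem_hardSites {z : Fin x.n} :
    .inl z ∈ x.hardSites ↔ ∃ i q, x.arg i q = z ∧ ¬ Takes (x.fn i) q false := by
  simp [mem_hardSites, Site.map, Forced]

theorem inr_mem_hardSites {y z : Fin x.n} : .inr (y, z) ∈ x.hardSites ↔
    ∃ i p q, (x.arg i p = y ∧ x.arg i q = z) ∧ Implies (x.fn i) q p := by
  simp [mem_hardSites, Site.map, Forced]

theorem eval_numAppsTerm (l : List ℕ) : numAppsTerm.eval x.enc l = x.apps.length :=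
  x.getD_nats_length

theorem eval_natPosTerm {i : ℕ} (hi : i ≤ x.apps.length) (l : List ℕ) :
    natPosTerm.eval x.enc (i :: l) = x.natPos i :=
  eval_iterBelow (fun _ _ => rfl) (hi.trans x.length_apps_le_size) rfl fun j hj => by
    rw [x.natPos_succ ⟨j, hj.trans_le hi⟩, ← x.getD_nats_natPos]
    rfl

theorem eval_realPosTerm {i : ℕ} (hi : i ≤ x.apps.length) (l : List ℕ) :
    realPosTerm.eval x.enc (i :: l) = x.realPos i :=
  eval_iterBelow (fun _ _ => rfl) (hi.trans x.length_apps_le_size) rfl fun j hj => by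
    let j' : Fin x.apps.length := ⟨j, hj.trans_le hi⟩
    have harity : (NTerm.getN (.call [1] natPosTerm)).eval x.enc (x.realPos j :: j :: i :: l) =
        (x.apps[j']).h.arity := by
      rw [← x.getD_nats_natPos, ← x.eval_natPosTerm j'.2.le []]
      rfl
    rw [x.realPos_succ j', ← eval_powTerm (x.tableAt j').arity_le, ← harity]
    rfl

/-- The environment that `NTerm.withApp` makes from `i :: l`. -/
def appEnv (i : Fin x.apps.length) (l : List ℕ) : List ℕ :=
  x.realPos i :: (x.apps[i]).h.arity :: x.natPos i :: i :: l

theorem eval_withApp_nat (b : NTerm) (i : Fin x.apps.length) (l : List ℕ) :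
    b.withApp.eval x.enc (i :: l) = b.eval x.enc (x.appEnv i l) := by
  rw [appEnv, ← x.eval_realPosTerm i.2.le [], ← x.getD_nats_natPos,
    ← x.eval_natPosTerm i.2.le []]
  rfl

theorem eval_withApp_real (b : RTerm) (i : Fin x.apps.length) (l : List ℕ) :
    b.withApp.eval x.enc (i :: l) = b.eval x.enc (x.appEnv i l) := by
  rw [appEnv, ← x.eval_realPosTerm i.2.le [], ← x.getD_nats_natPos,
    ← x.eval_natPosTerm i.2.le []]
  rfl

theorem eval_prodApps (b : RTerm) (l : List ℕ) :
    (RTerm.prodBelow numAppsTerm b.withApp).eval x.enc l = ∏ i, b.eval x.enc (x.appEnv i l) := by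
  rw [RTerm.eval_prodBelow (fun i => x.eval_numAppsTerm (i :: l)) x.length_apps_le_size]
  exact Finset.prod_congr rfl fun i _ => x.eval_withApp_real b i l

theorem holds_someApp (b : NTerm) (l : List ℕ) :
    (NTerm.sumBelow numAppsTerm b.withApp).Holds x.enc l ↔ ∃ i, b.Holds x.enc (x.appEnv i l) := by
  rw [holds_sumBelow (fun i => x.eval_numAppsTerm (i :: l)) x.length_apps_le_size]
  simp only [Holds, eval_withApp_nat]

theorem holds_argEq {s q z : NTerm} {l : List ℕ} {i : Fin x.apps.length} {q' z' : Fin _}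
    (hs : s.eval x.enc l = x.natPos i) (hq : q.eval x.enc l = (q' : Fin (x.apps[i]).h.arity))
    (hz : z.eval x.enc l = (z' : Fin x.n)) : (argEq s q z).Holds x.enc l ↔ x.arg i q' = z' := by
  rw [argEq, holds_eq, NTerm.eval, NTerm.eval, NTerm.eval, NTerm.eval, hs, hq, hz,
    x.getD_nats_arg, Fin.val_inj]

theorem holds_argEq_vertex (i : Fin x.apps.length) (q : Fin _) (z : Fin x.n) :
    (argEq (.var 3) (.var 0) (.var 5)).Holds x.enc (q :: x.appEnv i [z.val]) ↔ x.arg i q = z :=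
  x.holds_argEq rfl rfl rfl

theorem holds_argEq_edge (i : Fin x.apps.length) (p q : Fin _) (y z : Fin x.n) :
    (NTerm.mul (argEq (.var 4) (.var 1) (.var 6)) (argEq (.var 4) (.var 0) (.var 7))).Holds x.enc
      (q :: p :: x.appEnv i [y.val, z.val]) ↔ x.arg i p = y ∧ x.arg i q = z :=
  holds_mul.trans (and_congr (x.holds_argEq rfl rfl rfl) (x.holds_argEq rfl rfl rfl))

theorem eval_softInfluxTerm (z : Fin x.n) :
    softInfluxTerm.eval x.enc [z.val] = x.softRate (.inl z) := by
  simp only [softRate_inl, NNReal.coe_prod]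
  refine (x.eval_prodApps _ _).trans (Finset.prod_congr rfl fun i _ => ?_)
  refine (RTerm.eval_prodBelow (fun _ => rfl) (x.tableAt i).arity_le).trans
    (Finset.prod_congr rfl fun q _ => ?_)
  rw [RTerm.eval_ite (x.holds_argEq_vertex i q z), apply_ite NNReal.toReal, RTerm.eval_lit_one,
    NNReal.coe_one, ← (x.tableAt i).eval_vertexTerm]
  rfl

theorem eval_softFlowTerm (y z : Fin x.n) :
    softFlowTerm.eval x.enc [y.val, z.val] = x.softRate (.inr (y, z)) := by
  simp only [softRate_inr, NNReal.coe_prod]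
  refine (x.eval_prodApps _ _).trans (Finset.prod_congr rfl fun i _ => ?_)
  refine (RTerm.eval_prodBelow (fun _ => rfl) (x.tableAt i).arity_le).trans
    (Finset.prod_congr rfl fun p _ => ?_)
  refine (RTerm.eval_prodBelow (fun _ => rfl) (x.tableAt i).arity_le).trans
    (Finset.prod_congr rfl fun q _ => ?_)
  rw [RTerm.eval_ite (x.holds_argEq_edge i p q y z), apply_ite NNReal.toReal, RTerm.eval_lit_one,
    NNReal.coe_one, ← (x.tableAt i).eval_edgeTerm]
  rfl

theorem holds_hardVertexTerm (z : Fin x.n) :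
    hardVertexTerm.Holds x.enc [z.val] ↔ .inl z ∈ x.hardSites := by
  rw [inl_mem_hardSites]
  refine (x.holds_someApp _ _).trans (exists_congr fun i => ?_)
  refine (holds_sumBelow (fun _ => rfl) (x.tableAt i).arity_le).trans (exists_congr fun q => ?_)
  exact holds_mul.trans (and_congr (x.holds_argEq_vertex i q z)
    (holds_not.trans (not_congr ((x.tableAt i).holds_takesTerm q false))))

theorem holds_hardEdgeTerm (y z : Fin x.n) :
    hardEdgeTerm.Holds x.enc [y.val, z.val] ↔ .inr (y, z) ∈ x.hardSites := by
  rw [inr_mem_hardSites]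
  refine (x.holds_someApp _ _).trans (exists_congr fun i => ?_)
  refine (holds_sumBelow (fun _ => rfl) (x.tableAt i).arity_le).trans (exists_congr fun p => ?_)
  refine (holds_sumBelow (fun _ => rfl) (x.tableAt i).arity_le).trans (exists_congr fun q => ?_)
  exact holds_mul.trans (and_congr (x.holds_argEq_edge i p q y z)
    ((x.tableAt i).holds_impliesTerm q p))

theorem eval_prodVertices (a : RTerm) (l : List ℕ) :
    (RTerm.prodBelow sizeTerm a).eval x.enc l = ∏ z : Fin x.n, a.eval x.enc (z :: l) :=
  RTerm.eval_prodBelow (fun _ => rfl) x.n_le_size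

theorem eval_spreadTerm {a : RTerm} {l : List ℕ} {ρ : ℝ≥0} (ha : a.eval x.enc l = ρ) :
    (spreadTerm a).eval x.enc l = ((1 + ρ) * (1 + 1 / ρ) : ℝ≥0) := by
  simp [spreadTerm, RTerm.eval, ha]

theorem eval_penaltyTerm (l : List ℕ) :
    penaltyTerm.eval x.enc l = penaltyFactor x.softRate := by
  simp only [penaltyFactor, Fintype.prod_sum_type, Fintype.prod_prod_type, NNReal.coe_mul,
    NNReal.coe_prod]
  refine congrArg₂ (· * ·) Nat.cast_ofNat (congrArg₂ (· * ·) ?_ ?_)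
  · refine (x.eval_prodVertices _ l).trans (Finset.prod_congr rfl fun z _ => ?_)
    exact (x.eval_spreadTerm (x.eval_softInfluxTerm z)).trans (NNReal.coe_mul ..)
  · refine (x.eval_prodVertices _ l).trans (Finset.prod_congr rfl fun y _ => ?_)
    refine (x.eval_prodVertices _ (y :: l)).trans (Finset.prod_congr rfl fun z _ => ?_)
    exact (x.eval_spreadTerm (x.eval_softFlowTerm y z)).trans (NNReal.coe_mul ..)

theorem eval_influxTerm (z : Fin x.n) : influxTerm.eval x.enc [z.val] = x.rate (.inl z) := by
  classical
  rw [influxTerm, RTerm.eval, RTerm.eval_ite (x.holds_hardVertexTerm z), eval_softInfluxTerm,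
    eval_penaltyTerm, RTerm.eval_lit_one, rate, NNReal.coe_mul, apply_ite NNReal.toReal,
    NNReal.coe_one]

theorem eval_flowTerm (y z : Fin x.n) :
    flowTerm.eval x.enc [y.val, z.val] = x.rate (.inr (y, z)) := by
  classical
  rw [flowTerm, RTerm.eval, RTerm.eval_ite (x.holds_hardEdgeTerm y z), eval_softFlowTerm,
    eval_penaltyTerm, RTerm.eval_lit_one, rate, NNReal.coe_mul, apply_ite NNReal.toReal,
    NNReal.coe_one]

theorem eval_sizeTerm (l : List ℕ) : sizeTerm.eval x.enc l = x.n := rfl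

theorem out_loopVertices (a : Cmd) (l : List ℕ) : (Cmd.loopBelow sizeTerm a).out x.enc l =
    (List.finRange x.n).flatMap fun z : Fin x.n => a.out x.enc (z :: l) :=
  Cmd.out_loopBelow (fun _ => rfl) x.n_le_size

theorem out_flowCmd : flowCmd.out x.enc [] = [.inl x.n, .inl (x.n * x.n)] ++
    ((List.finRange x.n ×ˢ List.finRange x.n).flatMap fun e => [.inl e.1.val, .inl e.2.val]) ++
    ((List.finRange x.n).map fun z => .inr (x.rate (.inl z) : ℝ)) ++
    (List.finRange x.n ×ˢ List.finRange x.n).map fun e => .inr (x.rate (.inr e) : ℝ) := by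
  have hinflux (z : Fin x.n) : (RTerm.call [0] influxTerm).eval x.enc [z.val] = x.rate (.inl z) :=
    x.eval_influxTerm z
  have hflow (y z : Fin x.n) :
      (RTerm.call [1, 0] flowTerm).eval x.enc [z.val, y.val] = x.rate (.inr (y, z)) :=
    x.eval_flowTerm y z
  simp [flowCmd, Cmd.out, out_loopVertices, hinflux, hflow, NTerm.eval, eval_sizeTerm, SProd.sprod,
    List.product, List.flatMap_assoc, List.map_eq_flatMap]

theorem ofEntries_out_flowCmd (hF : F ⊆ IMopt) :
    Word.ofEntries (flowCmd.out x.enc []) = (x.toFlow hF).enc := by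
  rw [out_flowCmd, Word.ofEntries, FlowInst.enc, toFlow]
  simp [List.filterMap_flatMap, List.flatMap_map, List.ofFn_eq_map, Function.comp_def,
    List.filterMap_cons, List.length_product]

end CSPInst

end InstanceTerms

theorem unaryConstraints_subset_IMopt : unaryConstraints ⊆ IMopt := by
  rintro ⟨k, f⟩ (rfl : k = 1)
  refine ⟨[.unary 0 fun b => f fun _ => b], fun x => ?_⟩
  rw [List.map_singleton, List.prod_singleton, ImFactor.eval]
  congr 1
  funext i
  rw [Subsingleton.elim i 0]

end ProdCSP

theorem mainTheorem8 (F : Set ProdCSP.Constraint) (hF : F ⊆ ProdCSP.IMopt) :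
    (ProdCSP.maxProdCSPStar F).APTReducible ProdCSP.maxProdFlow := by
  have hF' : F ∪ ProdCSP.unaryConstraints ⊆ ProdCSP.IMopt :=
    Set.union_subset hF ProdCSP.unaryConstraints_subset_IMopt
  exact ProdCSP.MaxProblem.APTReducible.of_cmd ProdCSP.flowCmd (fun x => x.toFlow hF')
    (fun x => x.ofEntries_out_flowCmd hF') fun x ε _ hε σ hσ =>
      ⟨σ, rfl, x.isApprox_of_toFlow hF' hε σ hσ⟩
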